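/- **Setting.** Let $k\ge 2$, $\mu_1,\dots,\mu_k\in\mathbb R^d$ linearly independent, $\alpha_1,\dots,\alpha_k>0$ with $\sum_i\alpha_i=1$, and let $v\in\mathbb R^d$ satisfy $\langle\mu_1,v\rangle>0$ and, for some $\delta>0$, $\langle\mu_1,v\rangle\ge(1+\delta)\langle\mu_i,v\rangle$ for all $i\ne1$. Put $$m=\sum_i\alpha_i\mu_i,\qquad A=\sum_i\alpha_i\mu_i\mu_i^T,\qquad B=\sum_i\alpha_i\langle\mu_i,v\rangle\mu_i\mu_i^T,$$ $\lambda_1=1/\langle\mu_1,v\rangle$, $Z_{\lambda_1}=A-\lambda_1B$, $R=\max_i\|\mu_i\|$, and $a_1=\|\mu_1-\Pi_{\mathcal V}\mu_1\|$, where $\Pi_{\mathcal V}$ is the orthogonal projection onto $\mathcal V=\mathrm{span}\{\mu_2,\dots,\mu_k\}$. Write $\|\cdot\|$ for the Euclidean norm of vectors and the spectral norm of matrices, and $\sigma_j(M)$ for the $j$-th largest singular value of $M$. Let $$\eta_1=\max\{\alpha_1a_1(2a_1+1),20\},\quad \eta_2=\max\{\alpha_1a_1^2,10\},\quad \eta_3=\max\{1,\lambda_1,\sigma_1(B)\}.$$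 **Cancellation algorithm.** Input: symmetric matrices $\hat A,\hat B\in\mathbb R^{d\times d}$ and $\hat m\in\mathbb R^d$. (1) Let $\hat V$ be the $d\times k$ matrix whose columns are orthonormal eigenvectors of $\hat A$ for its $k$ largest eigenvalues. (2) Let $\lambda^*$ be the largest $\lambda\in\mathbb R$ such that $\hat V\hat V^T(\hat A-\lambda\hat B)\hat V\hat V^T$ is positive semidefinite. (3) Let $\hat v_2,\dots,\hat v_k$ be orthonormal singular vectors of $\hat A-\lambda^*\hat B$ for its $k-1$ largest singular values. (4) Let $\hat x_1=\hat m-\sum_{i=2}^k\langle \hat v_i,\hat m\rangle \hat v_i$ and $\hat v_1=\hat x_1/\|\hat x_1\|$. (5) Let $\hat c_i=\hat v_1^T\hat A\hat v_i$ and $\hat a_i=\hat c_i/\|\hat x_1\|$ for $1\le i\le k$. (6) Return $\hat\mu_1=\sum_{i=1}^k\hat a_i\hat v_i$ and $\hat\alpha_1=\hat c_1/\hat a_1^2$. **Theorem.** There are a universal constant $C>0$ and a positive function $\varepsilon_0$ of eight real variables such that the following holds for all $d$, $k$, $\alpha_i$, $\mu_i$, $v$ as above. Suppose that $\sigma_{k-1}(Z_{\lambda_1})\le\sigma_1(A)$,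 that $\hat A,\hat B$ are symmetric, that $$\max\{\|\hat A-A\|,\ \|\hat B-B\|,\ \|\hat m-m\|\}<\epsilon,$$ and that $\epsilon$ is small compared with the other parameters, namely $$\epsilon\le\varepsilon_0\big(\alpha_1,a_1,R,\lambda_1,\sigma_1(A),\sigma_k(A),\sigma_1(B),\sigma_{k-1}(Z_{\lambda_1})\big).$$ Then the cancellation algorithm can be carried out on $(\hat A,\hat B,\hat m)$, and whatever eigenvectors and singular vectors are chosen in steps (1) and (3), the divisors $\|\hat x_1\|$ and $\hat a_1$ are nonzero and the output satisfies $$\|\hat\mu_1-\mu_1\|<\frac{C\epsilon}{\alpha_1^2a_1^2}\left(\sigma_1(A)\Big(1+\frac{\alpha_1a_1}{\sigma_{k-1}(Z_{\lambda_1})}\Big)+\frac{\sigma_1(A)\,\eta_3R}{\sigma_{k-1}(Z_{\lambda_1})}\right),$$ $$|\hat\alpha_1-\alpha_1|<\frac{C\sigma_1(A)\epsilon}{\alpha_1a_1^3}\left(\eta_1+\frac{\eta_2R\,\eta_3}{\sigma_{k-1}(Z_{\lambda_1})}\right).$$ -/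

import Mathlib

/-- The vector space `ℝ^d` with its Euclidean norm. -/
abbrev Vec (d : ℕ) : Type := EuclideanSpace ℝ (Fin d)

/-- Real `d × d` matrices, as linear operators on `ℝ^d`; the norm is the spectral norm. -/
abbrev Op (d : ℕ) : Type := Vec d →L[ℝ] Vec d

namespace Mixture

/-- `m = ∑ α_i μ_i`. -/
noncomputable def momentM {d k : ℕ} (α : Fin k → ℝ) (μ : Fin k → Vec d) : Vec d :=
  ∑ i, α i • μ i

/-- `A = ∑ α_i μ_i μ_iᵀ`. -/
noncomputable def momentA {d k : ℕ} (α : Fin k → ℝ) (μ : Fin k → Vec d) : Op d :=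
  ∑ i, α i • InnerProductSpace.rankOne ℝ (μ i) (μ i)

/-- `B = ∑ α_i ⟨μ_i, v⟩ μ_i μ_iᵀ`. -/
noncomputable def momentB {d k : ℕ} (α : Fin k → ℝ) (μ : Fin k → Vec d) (v : Vec d) : Op d :=
  ∑ i, (α i * inner ℝ (μ i) v) • InnerProductSpace.rankOne ℝ (μ i) (μ i)

/-- `λ₁ = 1 / ⟨μ_1, v⟩`. -/
noncomputable def lambdaOne {d k : ℕ} [NeZero k] (μ : Fin k → Vec d) (v : Vec d) : ℝ :=
  1 / inner ℝ (μ 0) v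

/-- `a₁ = ‖μ_1 - Π μ_1‖`, with `Π` the orthogonal projection onto `span {μ_2, …, μ_k}`. -/
noncomputable def aOne {d k : ℕ} [NeZero k] (μ : Fin k → Vec d) : ℝ :=
  ‖μ 0 - (Submodule.span ℝ (μ '' {i | i ≠ 0})).starProjection (μ 0)‖

/-- `R = max_i ‖μ_i‖`. -/
noncomputable def maxNorm {d k : ℕ} (μ : Fin k → Vec d) : ℝ :=
  ⨆ i, ‖μ i‖

/-- The `j`-th largest singular value of `M`, counted from `j = 1` and with multiplicity. -/
noncomputable def sigma {d : ℕ} (j : ℕ) (M : Op d) : ℝ :=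
  (M : Vec d →ₗ[ℝ] Vec d).singularValues (j - 1)

/-- `u` lists `r` orthonormal eigenvectors of the symmetric matrix `T` that belong to its `r`
largest eigenvalues (counted with multiplicity): every eigenvalue that remains on the
orthogonal complement of `u` is at most each of the eigenvalues of `u`. -/
def IsTopEigenvectors {d r : ℕ} (T : Op d) (u : Fin r → Vec d) : Prop :=
  Orthonormal ℝ u ∧ ∃ e : Fin r → ℝ, (∀ j, T (u j) = e j • u j) ∧
    ∀ (c : ℝ) (y : Vec d), y ≠ 0 → T y = c • y → (∀ j, inner ℝ (u j) y = 0) → ∀ j, c ≤ e j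

/-- `u` lists `r` orthonormal (right) singular vectors of `M` that belong to its `r` largest
singular values, i.e. top eigenvectors of `Mᵀ M`. -/
def IsTopSingularVectors {d r : ℕ} (M : Op d) (u : Fin r → Vec d) : Prop :=
  IsTopEigenvectors (ContinuousLinearMap.adjoint M ∘L M) u

/-- The matrix `U Uᵀ`, where `U` has columns `u_1, …, u_r`. -/
noncomputable def gramProj {d r : ℕ} (u : Fin r → Vec d) : Op d :=
  ∑ j, InnerProductSpace.rankOne ℝ (u j) (u j)

/-- The choices made by one run of the cancellation algorithm on the input `(A, B, m)`:
the `k` top eigenvectors of `A` (columns of `V`), the result `lam` of the line search, and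
the `k - 1` top singular vectors `v_2, …, v_k` of `Z = A - lam • B`. -/
structure CancellationRun {d : ℕ} (k : ℕ) (A B : Op d) (m : Vec d) where
  V : Fin k → Vec d
  isTop_V : IsTopEigenvectors A V
  lam : ℝ
  isGreatest_lam :
    IsGreatest {l : ℝ | (gramProj V ∘L (A - l • B) ∘L gramProj V).IsPositive} lam
  tailVec : Fin (k - 1) → Vec d
  isTop_tailVec : IsTopSingularVectors (A - lam • B) tailVec

namespace CancellationRun

/-- `x₁ = m - V_{1:(k-1)} V_{1:(k-1)}ᵀ m`. -/
noncomputable def x₁ {d k : ℕ} {A B : Op d} {m : Vec d} (r : CancellationRun k A B m) : Vec d :=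
  m - gramProj r.tailVec m

/-- `v₁ = x₁ / ‖x₁‖`. -/
noncomputable def v₁ {d k : ℕ} {A B : Op d} {m : Vec d} (r : CancellationRun k A B m) : Vec d :=
  ‖r.x₁‖⁻¹ • r.x₁

/-- `c₁ = v₁ᵀ A v₁`. -/
noncomputable def c₁ {d k : ℕ} {A B : Op d} {m : Vec d} (r : CancellationRun k A B m) : ℝ :=
  inner ℝ r.v₁ (A r.v₁)

/-- `a₁ = c₁ / ‖x₁‖`. -/
noncomputable def a₁ {d k : ℕ} {A B : Op d} {m : Vec d} (r : CancellationRun k A B m) : ℝ :=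
  r.c₁ / ‖r.x₁‖

/-- `c_i = v₁ᵀ A v_i` for `i = 2, …, k`. -/
noncomputable def cTail {d k : ℕ} {A B : Op d} {m : Vec d} (r : CancellationRun k A B m)
    (j : Fin (k - 1)) : ℝ :=
  inner ℝ r.v₁ (A (r.tailVec j))

/-- `a_i = c_i / ‖x₁‖` for `i = 2, …, k`. -/
noncomputable def aTail {d k : ℕ} {A B : Op d} {m : Vec d} (r : CancellationRun k A B m)
    (j : Fin (k - 1)) : ℝ :=
  r.cTail j / ‖r.x₁‖

/-- The returned estimate `∑_{i=1}^k a_i v_i` of `μ_1`. -/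
noncomputable def muHat {d k : ℕ} {A B : Op d} {m : Vec d} (r : CancellationRun k A B m) :
    Vec d :=
  r.a₁ • r.v₁ + ∑ j, r.aTail j • r.tailVec j

/-- The returned estimate `c₁ / a₁²` of `α_1`. -/
noncomputable def alphaHat {d k : ℕ} {A B : Op d} {m : Vec d} (r : CancellationRun k A B m) : ℝ :=
  r.c₁ / r.a₁ ^ 2

end CancellationRun

/-- `η₁ = max {α₁ a₁ (2 a₁ + 1), 20}`. -/
noncomputable def etaOne (α₁ a₁ : ℝ) : ℝ := max (α₁ * a₁ * (2 * a₁ + 1)) 20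

/-- `η₂ = max {α₁ a₁², 10}`. -/
noncomputable def etaTwo (α₁ a₁ : ℝ) : ℝ := max (α₁ * a₁ ^ 2) 10

/-- `η₃ = max {1, λ₁, σ₁(B)}`. -/
noncomputable def etaThree (lam₁ sB : ℝ) : ℝ := max 1 (max lam₁ sB)

/-- The bound on the error of the estimate of `μ_1`, where `sA = σ₁(A)`, `sZ = σ_{k-1}(Z_{λ₁})`,
`sB = σ₁(B)`. -/
noncomputable def muBound (C ε α₁ a₁ R lam₁ sA sB sZ : ℝ) : ℝ :=
  C * ε / (α₁ ^ 2 * a₁ ^ 2) *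
    (sA * (1 + α₁ * a₁ / sZ) + sA * etaThree lam₁ sB * R / sZ)

/-- The bound on the error of the estimate of `α_1`, with the same notation. -/
noncomputable def alphaBound (C ε α₁ a₁ R lam₁ sA sB sZ : ℝ) : ℝ :=
  C * sA * ε / (α₁ * a₁ ^ 3) *
    (etaOne α₁ a₁ + etaTwo α₁ a₁ * R * etaThree lam₁ sB / sZ)

end Mixture

/-!
The exact moments are governed by two subspaces: the span `W` of all means and the span `V` of the
means other than `μ₁`. Let `n` be the unit vector of `W` orthogonal to `V`. Then `A` vanishes on
`Wᗮ`, `A n = α₁ a₁ μ₁`, `m - P_V m = α₁ a₁ n`, and `Z = A - λ₁ B` is positive definite on `V` and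
vanishes on `Vᗮ`. Hence on exact input the line search stops at `λ₁`, the tail vectors span `V`, the
residual is `α₁ a₁ n`, and the output is exact. These facts are collected in `MomentModel`. The
perturbation analysis has to keep the constants of the first-order error under control, and the
following observations do this without second-order expansions.

* Line search. The top `k` eigenvectors of `Ahat` span a subspace `U` close to `W`, so some `x ∈ U`
  projects to `n`. Since `A` and `B` vanish on `Wᗮ`, the quadratic form of `A - λ B` at `x` equals
  that at `n`, namely `α₁ a₁² (1 - λ / λ₁)`; this bounds `λ*` from above (`lam_le`). For the lower
  bound (`pencil_nonneg`) the form is a combination of those of `A` and `Z`, where `Z` controls the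
  component in `V`, and `α₁ ⟨μ₁, x⟩²` the component along `n`. So the relative error of `λ*` is at
  most `4 ε (1 + λ₁) / (α₁ a₁²)`, which does not involve `σ_k(A)`.
* Angle. Every `x` in the span of the tail vectors has the form `Ẑ z` with
  `‖z‖ ≤ 2 ‖x‖ / σ_{k-1}(Z)`, where `Ẑ = Ahat - λ* Bhat`, and `Z z ∈ V`, so the distance of `x`
  from `V` is that of `(Ẑ - Z) z`. The error of `λ*` contributes only through the part of `B` that
  leaves `V`, and this part has norm `α₁ a₁ ‖μ₁‖ / λ₁` because `λ₁ B = A - Z` (`close_V`).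
* Output. The computed direction `w` is orthogonal to the tail vectors, so its component in `V`
  is bounded by the angle error alone, and `A w = ⟨n, w⟩ α₁ a₁ μ₁ + A (P_V w)`. Both error bounds
  follow from this identity (`norm_mean_sub_le`, `abs_weight_sub_le`), together with
  `α₁ ‖μ₁‖² ≤ σ₁(A)`, `a₁ ≤ ‖μ₁‖ ≤ R` and `σ_{k-1}(Z) ≤ σ₁(A)`.

The smallness of `ε` is needed only for finitely many inequalities between `ε` and the parameters
(`SmallError`), each of which holds near `ε = 0` by continuity.
-/

namespace Mixture

open Module

/-! ### Quadratic forms in an eigenbasis -/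

lemma norm_sq_eq_sum_inner_sq {F : Type*} [NormedAddCommGroup F] [InnerProductSpace ℝ F] {N : ℕ}
    (b : OrthonormalBasis (Fin N) ℝ F) (x : F) : ‖x‖ ^ 2 = ∑ i, inner ℝ (b i) x ^ 2 := by
  rw [← b.sum_sq_norm_inner_right x]
  simp

section Spectral

variable {F : Type*} [NormedAddCommGroup F] [InnerProductSpace ℝ F] [FiniteDimensional ℝ F]

/-- The quadratic form of a symmetric operator in coordinates with respect to an eigenbasis. -/
lemma inner_apply_eq_sum_eigenvalues {T : F →ₗ[ℝ] F} (hT : T.IsSymmetric) {N : ℕ}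
    (hN : finrank ℝ F = N) (x : F) :
    inner ℝ x (T x) =
      ∑ i, hT.eigenvalues hN i * inner ℝ (hT.eigenvectorBasis hN i) x ^ 2 := by
  rw [← (hT.eigenvectorBasis hN).sum_inner_mul_inner x (T x)]
  refine Finset.sum_congr rfl fun i _ => ?_
  have h : inner ℝ (hT.eigenvectorBasis hN i) (T x)
      = hT.eigenvalues hN i * inner ℝ (hT.eigenvectorBasis hN i) x := by
    rw [← hT, hT.apply_eigenvectorBasis, inner_smul_left]
    simp
  rw [h, real_inner_comm]
  ring

lemma inner_apply_le_of_forall_eigenvalues_le {T : F →ₗ[ℝ] F} (hT : T.IsSymmetric) {c : ℝ}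
    (hc : ∀ (e : ℝ) (y : F), y ≠ 0 → T y = e • y → e ≤ c) (x : F) :
    inner ℝ x (T x) ≤ c * ‖x‖ ^ 2 := by
  rw [inner_apply_eq_sum_eigenvalues hT rfl, norm_sq_eq_sum_inner_sq (hT.eigenvectorBasis rfl),
    Finset.mul_sum]
  refine Finset.sum_le_sum fun i _ => mul_le_mul_of_nonneg_right ?_ (sq_nonneg _)
  exact hc _ _ ((hT.eigenvectorBasis rfl).orthonormal.ne_zero i) (hT.apply_eigenvectorBasis rfl i)

end Spectral

/-! ### Top eigenvectors -/

section TopEigenvectors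

variable {d r : ℕ}

/-- If every eigenvalue on the orthogonal complement of `u` is at most each eigenvalue of `u`, then
so is the Rayleigh quotient there, because the complement is invariant. -/
lemma inner_apply_le_of_orthogonal {T : Op d} (hT : T.IsSymmetric) {u : Fin r → Vec d}
    {e : Fin r → ℝ} (he : ∀ j, T (u j) = e j • u j)
    (hmax : ∀ (c : ℝ) (y : Vec d), y ≠ 0 → T y = c • y → (∀ j, inner ℝ (u j) y = 0) →
      ∀ j, c ≤ e j) (j : Fin r) {x : Vec d} (hx : ∀ i, inner ℝ (u i) x = 0) :
    inner ℝ x (T x) ≤ e j * ‖x‖ ^ 2 := by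
  set K : Submodule ℝ (Vec d) := (Submodule.span ℝ (Set.range u))ᗮ with hK
  have memK : ∀ y, y ∈ K ↔ ∀ i, inner ℝ (u i) y = 0 := by
    intro y
    rw [hK, Submodule.mem_orthogonal]
    constructor
    · intro h i
      exact h _ (Submodule.subset_span ⟨i, rfl⟩)
    · intro h w hw
      induction hw using Submodule.span_induction with
      | mem w hw => obtain ⟨i, rfl⟩ := hw; exact h i
      | zero => simp
      | add a b _ _ ha hb => rw [inner_add_left, ha, hb, add_zero]
      | smul c a _ ha => rw [inner_smul_left, ha, mul_zero]
  have hinv : ∀ y ∈ K, (T : Vec d →ₗ[ℝ] Vec d) y ∈ K := by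
    intro y hy
    rw [memK] at hy ⊢
    intro i
    rw [← hT]
    simp [he, inner_smul_left, hy i]
  have hres := hT.restrict_invariant hinv
  have := inner_apply_le_of_forall_eigenvalues_le hres (c := e j) ?_ ⟨x, (memK x).2 hx⟩
  · simpa using this
  · intro c y hy hTy
    refine hmax c y (by simpa using hy) ?_ ((memK _).1 y.2) j
    simpa using congrArg Subtype.val hTy

/-- A symmetric operator has a list of `r` top eigenvectors for every `r ≤ d`. -/
lemma exists_isTopEigenvectors {T : Op d} (hT : T.IsSymmetric) (hr : r ≤ d) :
    ∃ u : Fin r → Vec d, IsTopEigenvectors T u := by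
  have hd : finrank ℝ (Vec d) = d := by simp
  set b := LinearMap.IsSymmetric.eigenvectorBasis hT hd with hb
  set e := LinearMap.IsSymmetric.eigenvalues hT hd with he
  have hbe : ∀ i, T (b i) = e i • b i := fun i =>
    LinearMap.IsSymmetric.apply_eigenvectorBasis hT hd i
  refine ⟨fun j => b (Fin.castLE hr j),
    b.orthonormal.comp _ (Fin.castLE_injective hr), fun j => e (Fin.castLE hr j),
    fun j => hbe _, ?_⟩
  intro c y hy hTy hort j
  obtain ⟨i, hi⟩ : ∃ i, inner ℝ (b i) y ≠ 0 := by
    by_contra! h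
    apply hy
    have := norm_sq_eq_sum_inner_sq b y
    simpa [h] using this
  have hri : r ≤ i := by
    by_contra! h
    exact hi (hort ⟨i, h⟩)
  have hci : c = e i := by
    have h1 : inner ℝ (T (b i)) y = inner ℝ (b i) (T y) := hT _ _
    rw [hbe, hTy, inner_smul_left, inner_smul_right] at h1
    exact (mul_right_cancel₀ hi (by simpa using h1)).symm
  rw [hci]
  refine LinearMap.IsSymmetric.eigenvalues_antitone hT hd ?_
  rw [Fin.le_def]
  simp only [Fin.val_castLE]
  omega

/-- A lower bound for the quadratic form on an `r`-dimensional subspace bounds the top `r`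
eigenvalues from below (half of the Courant–Fischer principle). -/
lemma IsTopEigenvectors.exists_eigenvalues {T : Op d} (hT : T.IsSymmetric) {u : Fin r → Vec d}
    (hu : IsTopEigenvectors T u) {S : Submodule ℝ (Vec d)} (hS : finrank ℝ S = r) {c : ℝ}
    (hc : ∀ x ∈ S, c * ‖x‖ ^ 2 ≤ inner ℝ x (T x)) :
    ∃ e : Fin r → ℝ, (∀ j, T (u j) = e j • u j) ∧ ∀ j, c ≤ e j := by
  obtain ⟨hon, e, he, hmax⟩ := hu
  refine ⟨e, he, fun j => ?_⟩
  -- a nonzero `x ∈ S` orthogonal to all `u i`, `i ≠ j`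
  let f : S →ₗ[ℝ] ({i : Fin r // i ≠ j} → ℝ) :=
    LinearMap.pi fun i => (innerₛₗ ℝ (u i)) ∘ₗ S.subtype
  have hlt : finrank ℝ ({i : Fin r // i ≠ j} → ℝ) < finrank ℝ S := by
    rw [finrank_fintype_fun_eq_card, hS]
    have hcard := Fintype.card_subtype_lt (p := fun i : Fin r => i ≠ j) (x := j) (by simp)
    simpa using hcard
  obtain ⟨x, hx, hx0⟩ := Submodule.exists_mem_ne_zero_of_ne_bot
    (LinearMap.ker_ne_bot_of_finrank_lt (f := f) hlt)
  have hxi : ∀ i, i ≠ j → inner ℝ (u i) (x : Vec d) = 0 := by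
    intro i hi
    have := congrFun (LinearMap.mem_ker.1 hx) ⟨i, hi⟩
    simpa [f] using this
  set a := inner ℝ (u j) (x : Vec d) with ha
  have huj : ‖u j‖ = 1 := hon.1 j
  have hort : ∀ i, inner ℝ (u i) ((x : Vec d) - a • u j) = 0 := by
    intro i
    rw [inner_sub_right, inner_smul_right]
    by_cases h : i = j
    · subst h
      simp [← ha, huj]
    · rw [hxi i h, hon.2 h]
      simp
  set y := (x : Vec d) - a • u j with hy
  have hxy : (x : Vec d) = a • u j + y := by simp [hy]
  have h1 := inner_apply_le_of_orthogonal hT he hmax j hort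
  have h2 := hc x x.2
  have huy : inner ℝ (u j) y = 0 := hort j
  have h3 : inner ℝ (x : Vec d) (T x) = e j * a ^ 2 + inner ℝ y (T y) := by
    have h4 : inner ℝ (u j) (T y) = 0 := by
      have : inner ℝ (T (u j)) y = inner ℝ (u j) (T y) := hT _ _
      rw [← this, he, inner_smul_left, huy, mul_zero]
    have h5 : inner ℝ y (u j) = 0 := by rw [real_inner_comm, huy]
    rw [hxy, map_add, map_smul, he]
    simp only [inner_add_left, inner_add_right, inner_smul_left, inner_smul_right, h4, h5,
      real_inner_self_eq_norm_sq, huj]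
    simp
    ring
  have h6 : ‖(x : Vec d)‖ ^ 2 = a ^ 2 + ‖y‖ ^ 2 := by
    rw [← real_inner_self_eq_norm_sq, hxy]
    have h5 : inner ℝ y (u j) = 0 := by rw [real_inner_comm, huy]
    simp only [inner_add_left, inner_add_right, inner_smul_left, inner_smul_right, h5, huy,
      real_inner_self_eq_norm_sq, huj]
    simp
    ring
  have h7 : 0 < ‖(x : Vec d)‖ ^ 2 := by
    have : (x : Vec d) ≠ 0 := by simpa using hx0
    positivity
  refine le_of_mul_le_mul_right ?_ h7
  calc c * ‖(x : Vec d)‖ ^ 2 ≤ e j * a ^ 2 + inner ℝ y (T y) := by rw [← h3]; exact h2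
    _ ≤ e j * ‖(x : Vec d)‖ ^ 2 := by rw [h6]; linarith

/-- An operator with eigenvectors `u` and eigenvalues at least `c > 0` is boundedly invertible
on the span of `u`. -/
lemma exists_preimage_of_mem_span {T : Op d} {u : Fin r → Vec d} (hon : Orthonormal ℝ u)
    {e : Fin r → ℝ} (he : ∀ j, T (u j) = e j • u j) {c : ℝ} (hc : 0 < c) (hce : ∀ j, c ≤ e j)
    {x : Vec d} (hx : x ∈ Submodule.span ℝ (Set.range u)) :
    ∃ y, T y = x ∧ c * ‖y‖ ≤ ‖x‖ := by
  obtain ⟨a, rfl⟩ := (Submodule.mem_span_range_iff_exists_fun ℝ).1 hx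
  have hpos : ∀ j, 0 < e j := fun j => hc.trans_le (hce j)
  have hnorm : ∀ f : Fin r → ℝ, ‖∑ j, f j • u j‖ ^ 2 = ∑ j, f j ^ 2 := by
    intro f
    rw [← real_inner_self_eq_norm_sq, hon.inner_sum]
    simp [sq]
  refine ⟨∑ j, (a j / e j) • u j, ?_, ?_⟩
  · rw [map_sum]
    refine Finset.sum_congr rfl fun j _ => ?_
    rw [map_smul, he, smul_smul, div_mul_cancel₀ _ (hpos j).ne']
  · refine le_of_sq_le_sq ?_ (norm_nonneg _)
    rw [mul_pow, hnorm, hnorm, Finset.mul_sum]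
    refine Finset.sum_le_sum fun j _ => ?_
    rw [← mul_pow, ← sq_abs, ← sq_abs (a j)]
    refine pow_le_pow_left₀ (abs_nonneg _) ?_ 2
    rw [abs_mul, abs_div, abs_of_pos hc, abs_of_pos (hpos j), mul_div_assoc',
      div_le_iff₀ (hpos j), mul_comm]
    exact mul_le_mul_of_nonneg_left (hce j) (abs_nonneg _)

lemma gramProj_eq_starProjection {u : Fin r → Vec d} (hon : Orthonormal ℝ u) :
    gramProj u = (Submodule.span ℝ (Set.range u)).starProjection := by
  ext1 x
  refine (Submodule.eq_starProjection_of_mem_of_inner_eq_zero ?_ ?_).symm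
  · simp only [gramProj, _root_.sum_apply, InnerProductSpace.rankOne_apply]
    exact Submodule.sum_mem _ fun j _ => Submodule.smul_mem _ _ (Submodule.subset_span ⟨j, rfl⟩)
  · intro w hw
    induction hw using Submodule.span_induction with
    | mem w hw =>
      obtain ⟨i, rfl⟩ := hw
      simp only [gramProj, _root_.sum_apply, InnerProductSpace.rankOne_apply]
      rw [inner_sub_left, hon.inner_left_fintype, real_inner_comm]
      simp
    | zero => simp
    | add a b _ _ ha hb => rw [inner_add_right, ha, hb, add_zero]
    | smul c a _ ha => rw [inner_smul_right, ha, mul_zero]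

lemma finrank_span_of_orthonormal {u : Fin r → Vec d} (hon : Orthonormal ℝ u) :
    finrank ℝ (Submodule.span ℝ (Set.range u)) = r := by
  simpa using finrank_span_eq_card hon.linearIndependent

end TopEigenvectors

/-! ### Projections to nearby subspaces -/

section Projections

variable {F : Type*} [NormedAddCommGroup F] [InnerProductSpace ℝ F] [FiniteDimensional ℝ F]

lemma norm_sq_eq_starProjection_add (S : Submodule ℝ F) (x : F) :
    ‖x‖ ^ 2 = ‖S.starProjection x‖ ^ 2 + ‖x - S.starProjection x‖ ^ 2 := by
  have h := Submodule.norm_sq_eq_add_norm_sq_starProjection x S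
  rwa [Submodule.starProjection_orthogonal_val] at h

lemma norm_sub_starProjection_le (S : Submodule ℝ F) (x : F) :
    ‖x - S.starProjection x‖ ≤ ‖x‖ := by
  refine le_of_sq_le_sq ?_ (norm_nonneg _)
  rw [norm_sq_eq_starProjection_add S x]
  nlinarith [sq_nonneg ‖S.starProjection x‖]

lemma inner_starProjection_sub (S : Submodule ℝ F) (x : F) {y : F} (hy : y ∈ S) :
    inner ℝ y (x - S.starProjection x) = 0 := by
  rw [real_inner_comm]
  exact Submodule.starProjection_inner_eq_zero x y hy

lemma norm_sub_starProjection_le_norm_sub (S : Submodule ℝ F) (x : F) {y : F} (hy : y ∈ S) :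
    ‖x - S.starProjection x‖ ≤ ‖x - y‖ := by
  have h := norm_sub_starProjection_le S (x - y)
  rwa [map_sub, Submodule.starProjection_eq_self_iff.2 hy, sub_sub_sub_cancel_right] at h

variable {U S : Submodule ℝ F} {γ : ℝ}

/-- Projecting a vector of `U` to a nearby subspace `S` does not shrink it much. -/
lemma norm_sq_le_two_mul_of_close (hγ : γ ≤ 1 / 2)
    (h : ∀ x ∈ U, ‖x - S.starProjection x‖ ≤ γ * ‖x‖) {x : F} (hx : x ∈ U) :
    ‖x‖ ^ 2 ≤ 2 * ‖S.starProjection x‖ ^ 2 := by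
  have h1 := norm_sq_eq_starProjection_add S x
  have h2 : ‖x - S.starProjection x‖ ≤ 1 / 2 * ‖x‖ :=
    (h x hx).trans (mul_le_mul_of_nonneg_right hγ (norm_nonneg _))
  have h3 := pow_le_pow_left₀ (norm_nonneg _) h2 2
  nlinarith [sq_nonneg ‖x‖]

/-- If `U` is close to `S` and both have the same dimension, the orthogonal projection maps `U`
onto `S`. -/
lemma exists_mem_starProjection_eq (hdim : finrank ℝ U = finrank ℝ S) (hγ : γ ≤ 1 / 2)
    (h : ∀ x ∈ U, ‖x - S.starProjection x‖ ≤ γ * ‖x‖) {w : F} (hw : w ∈ S) :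
    ∃ x ∈ U, S.starProjection x = w := by
  let f : U →ₗ[ℝ] S := (S.orthogonalProjectionOnto : F →ₗ[ℝ] S) ∘ₗ U.subtype
  have hf : ∀ x : U, (f x : F) = S.starProjection x := fun x => rfl
  have hinj : Function.Injective f := by
    rw [← LinearMap.ker_eq_bot, LinearMap.ker_eq_bot']
    intro x hx
    have h1 := norm_sq_le_two_mul_of_close hγ h x.2
    rw [← hf, hx] at h1
    have h2 : ‖(x : F)‖ ^ 2 ≤ 0 := by simpa using h1
    have h3 : ‖(x : F)‖ = 0 := by nlinarith [sq_nonneg ‖(x : F)‖]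
    simpa using h3
  obtain ⟨x, hx⟩ := (LinearMap.injective_iff_surjective_of_finrank_eq_finrank hdim).1 hinj ⟨w, hw⟩
  exact ⟨x, x.2, by rw [← hf, hx]⟩

/-- For subspaces of equal dimension, closeness of `U` to `S` gives closeness of `S` to `U`. -/
lemma norm_sub_starProjection_le_of_close (hdim : finrank ℝ U = finrank ℝ S) (hγ0 : 0 ≤ γ)
    (hγ : γ ≤ 1 / 2) (h : ∀ x ∈ U, ‖x - S.starProjection x‖ ≤ γ * ‖x‖) {w : F} (hw : w ∈ S) :
    ‖w - U.starProjection w‖ ≤ 2 * γ * ‖w‖ := by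
  obtain ⟨x, hx, rfl⟩ := exists_mem_starProjection_eq hdim hγ h hw
  have h1 := norm_sq_le_two_mul_of_close hγ h hx
  have h2 : ‖x‖ ≤ 2 * ‖S.starProjection x‖ := by
    refine le_of_sq_le_sq ?_ (by positivity)
    nlinarith [sq_nonneg ‖S.starProjection x‖]
  calc _ ≤ ‖S.starProjection x - x‖ := norm_sub_starProjection_le_norm_sub U _ hx
    _ = ‖x - S.starProjection x‖ := norm_sub_rev _ _
    _ ≤ γ * ‖x‖ := h x hx
    _ ≤ γ * (2 * ‖S.starProjection x‖) := mul_le_mul_of_nonneg_left h2 hγ0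
    _ = _ := by ring

end Projections

/-! ### Singular values -/

section SingularValues

variable {d : ℕ}

lemma norm_sq_apply_eq_sum_singularValues (T : Op d) (x : Vec d) :
    ‖T x‖ ^ 2 = ∑ i : Fin d, (T : Vec d →ₗ[ℝ] Vec d).singularValues i ^ 2 *
      inner ℝ ((T : Vec d →ₗ[ℝ] Vec d).isSymmetric_adjoint_comp_self.eigenvectorBasis
        (by simp : finrank ℝ (Vec d) = d) i) x ^ 2 := by
  have h := inner_apply_eq_sum_eigenvalues
    (T : Vec d →ₗ[ℝ] Vec d).isSymmetric_adjoint_comp_self (by simp : finrank ℝ (Vec d) = d) x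
  simp only [LinearMap.sq_singularValues_fin _ (by simp : finrank ℝ (Vec d) = d)]
  rw [← h, LinearMap.comp_apply, LinearMap.adjoint_inner_right, real_inner_self_eq_norm_sq]
  rfl

lemma sigma_nonneg (j : ℕ) (T : Op d) : 0 ≤ sigma j T := LinearMap.singularValues_nonneg _ _

lemma norm_apply_le_sigma_one (T : Op d) (x : Vec d) : ‖T x‖ ≤ sigma 1 T * ‖x‖ := by
  refine le_of_sq_le_sq ?_ (mul_nonneg (sigma_nonneg _ _) (norm_nonneg _))
  rw [norm_sq_apply_eq_sum_singularValues, mul_pow, norm_sq_eq_sum_inner_sq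
    ((T : Vec d →ₗ[ℝ] Vec d).isSymmetric_adjoint_comp_self.eigenvectorBasis
      (by simp : finrank ℝ (Vec d) = d)) x, Finset.mul_sum]
  refine Finset.sum_le_sum fun i _ => mul_le_mul_of_nonneg_right ?_ (sq_nonneg _)
  exact pow_le_pow_left₀ (LinearMap.singularValues_nonneg _ _)
    (LinearMap.singularValues_antitone _ (Nat.zero_le _)) 2

/-- The smallest nonzero singular value bounds an operator from below on the orthogonal
complement of its kernel. -/
lemma sigma_finrank_range_mul_norm_le (T : Op d) {x : Vec d}
    (hx : ∀ y, T y = 0 → inner ℝ y x = 0) {r : ℕ}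
    (hr : finrank ℝ (T : Vec d →ₗ[ℝ] Vec d).range = r) :
    sigma r T * ‖x‖ ≤ ‖T x‖ := by
  refine le_of_sq_le_sq ?_ (norm_nonneg _)
  set b := (T : Vec d →ₗ[ℝ] Vec d).isSymmetric_adjoint_comp_self.eigenvectorBasis
      (by simp : finrank ℝ (Vec d) = d) with hb
  rw [norm_sq_apply_eq_sum_singularValues, mul_pow, norm_sq_eq_sum_inner_sq b x, Finset.mul_sum]
  refine Finset.sum_le_sum fun i _ => ?_
  by_cases h : (i : ℕ) ≤ r - 1
  · refine mul_le_mul_of_nonneg_right ?_ (sq_nonneg _)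
    exact pow_le_pow_left₀ (LinearMap.singularValues_nonneg _ _)
      (LinearMap.singularValues_antitone _ h) 2
  · have hs : (T : Vec d →ₗ[ℝ] Vec d).singularValues i = 0 := by
      rw [LinearMap.singularValues_eq_zero_iff_le_finrank_range, hr]
      omega
    have hTb : T (b i) = 0 := by
      have h1 := norm_sq_apply_eq_sum_singularValues T (b i)
      rw [Finset.sum_eq_single i] at h1
      · rw [hs] at h1
        simpa using h1
      · intro j _ hj
        rw [← hb, b.orthonormal.2 hj]
        simp
      · simp
    rw [← hb, hx _ hTb]
    simp

/-- For a positive semidefinite operator the smallest nonzero singular value also bounds the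
quadratic form from below off the kernel. -/
lemma sigma_finrank_range_mul_norm_sq_le {T : Op d} (hT : T.IsSymmetric)
    (hpos : ∀ x, 0 ≤ inner ℝ x (T x)) {x : Vec d}
    (hx : ∀ y, T y = 0 → inner ℝ y x = 0) {r : ℕ}
    (hr : finrank ℝ (T : Vec d →ₗ[ℝ] Vec d).range = r) :
    sigma r T * ‖x‖ ^ 2 ≤ inner ℝ x (T x) := by
  have hd : finrank ℝ (Vec d) = d := by simp
  have hsum := inner_apply_eq_sum_eigenvalues (T := (T : Vec d →ₗ[ℝ] Vec d)) hT hd x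
  set b := LinearMap.IsSymmetric.eigenvectorBasis hT hd with hb
  set e := LinearMap.IsSymmetric.eigenvalues hT hd with he
  have hbe : ∀ i, T (b i) = e i • b i := fun i =>
    LinearMap.IsSymmetric.apply_eigenvectorBasis hT hd i
  have hbn : ∀ i, ‖b i‖ = 1 := fun i => b.orthonormal.1 i
  rw [show inner ℝ x (T x) = _ from hsum, norm_sq_eq_sum_inner_sq b x, Finset.mul_sum]
  refine Finset.sum_le_sum fun i _ => ?_
  by_cases h0 : e i = 0
  · rw [hx (b i) (by rw [hbe, h0, zero_smul])]
    simp
  · refine mul_le_mul_of_nonneg_right ?_ (sq_nonneg _)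
    have hei : 0 ≤ e i := by
      have := hpos (b i)
      rw [hbe, inner_smul_right, real_inner_self_eq_norm_sq, hbn] at this
      simpa using this
    have h1 := sigma_finrank_range_mul_norm_le T (x := b i) (fun y hy => by
      have h2 : inner ℝ (T y) (b i) = inner ℝ y (T (b i)) := hT _ _
      rw [hy, hbe, inner_zero_left, inner_smul_right] at h2
      exact (mul_eq_zero.1 h2.symm).resolve_left h0) hr
    rw [hbe, norm_smul, hbn, Real.norm_of_nonneg hei] at h1
    simpa using h1

end SingularValues

/-! ### Operators `∑ c_i μ_i μ_iᵀ` -/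

section FrameOperator

variable {d k : ℕ}

/-- The operator `∑ c_i μ_i μ_iᵀ`. -/
noncomputable def frameOp (c : Fin k → ℝ) (μ : Fin k → Vec d) : Op d :=
  ∑ i, c i • InnerProductSpace.rankOne ℝ (μ i) (μ i)

variable {c : Fin k → ℝ} {μ : Fin k → Vec d}

lemma frameOp_apply (x : Vec d) : frameOp c μ x = ∑ i, (c i * inner ℝ (μ i) x) • μ i := by
  simp [frameOp, smul_smul]

lemma inner_frameOp_apply (x y : Vec d) :
    inner ℝ x (frameOp c μ y) = ∑ i, c i * inner ℝ (μ i) y * inner ℝ (μ i) x := by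
  simp only [frameOp_apply, inner_sum, inner_smul_right]
  exact Finset.sum_congr rfl fun i _ => by rw [real_inner_comm (μ i) x]

lemma frameOp_isSymmetric : (frameOp c μ).IsSymmetric := by
  intro x y
  change inner ℝ (frameOp c μ x) y = inner ℝ x (frameOp c μ y)
  rw [real_inner_comm, inner_frameOp_apply, inner_frameOp_apply]
  exact Finset.sum_congr rfl fun i _ => by ring

variable {s : Set (Fin k)}

lemma inner_frameOp_self_nonneg (hpos : ∀ i ∈ s, 0 < c i) (hzero : ∀ i, i ∉ s → c i = 0)
    (i : Fin k) (x : Vec d) : 0 ≤ c i * inner ℝ (μ i) x * inner ℝ (μ i) x := by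
  rw [mul_assoc]
  refine mul_nonneg ?_ (mul_self_nonneg _)
  by_cases h : i ∈ s
  · exact (hpos i h).le
  · exact (hzero i h).ge

lemma frameOp_ker (hpos : ∀ i ∈ s, 0 < c i) (hzero : ∀ i, i ∉ s → c i = 0) :
    (frameOp c μ : Vec d →ₗ[ℝ] Vec d).ker = (Submodule.span ℝ (μ '' s))ᗮ := by
  ext x
  rw [LinearMap.mem_ker, Submodule.mem_orthogonal]
  constructor
  · intro h w hw
    have h0 : ∑ i, c i * inner ℝ (μ i) x * inner ℝ (μ i) x = 0 := by
      rw [← inner_frameOp_apply]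
      change inner ℝ x ((frameOp c μ : Vec d →ₗ[ℝ] Vec d) x) = 0
      rw [h, inner_zero_right]
    rw [Finset.sum_eq_zero_iff_of_nonneg
      fun i _ => inner_frameOp_self_nonneg hpos hzero i x] at h0
    induction hw using Submodule.span_induction with
    | mem w hw =>
      obtain ⟨i, hi, rfl⟩ := hw
      have h1 := h0 i (Finset.mem_univ _)
      rw [mul_assoc] at h1
      exact mul_self_eq_zero.1 ((mul_eq_zero.1 h1).resolve_left (hpos i hi).ne')
    | zero => simp
    | add a b _ _ ha hb => rw [inner_add_left, ha, hb, add_zero]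
    | smul c a _ ha => rw [inner_smul_left, ha, mul_zero]
  · intro h
    change frameOp c μ x = 0
    rw [frameOp_apply]
    refine Finset.sum_eq_zero fun i _ => ?_
    by_cases hi : i ∈ s
    · rw [h _ (Submodule.subset_span ⟨i, hi, rfl⟩), mul_zero, zero_smul]
    · rw [hzero i hi, zero_mul, zero_smul]

lemma frameOp_apply_starProjection (hpos : ∀ i ∈ s, 0 < c i) (hzero : ∀ i, i ∉ s → c i = 0)
    (x : Vec d) :
    frameOp c μ ((Submodule.span ℝ (μ '' s)).starProjection x) = frameOp c μ x := by
  have h : x - (Submodule.span ℝ (μ '' s)).starProjection x ∈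
      (frameOp c μ : Vec d →ₗ[ℝ] Vec d).ker := by
    rw [frameOp_ker hpos hzero]
    exact Submodule.sub_starProjection_mem_orthogonal x
  have h' : frameOp c μ (x - (Submodule.span ℝ (μ '' s)).starProjection x) = 0 := h
  rw [map_sub, sub_eq_zero] at h'
  exact h'.symm

lemma frameOp_range (hpos : ∀ i ∈ s, 0 < c i) (hzero : ∀ i, i ∉ s → c i = 0) :
    (frameOp c μ : Vec d →ₗ[ℝ] Vec d).range = Submodule.span ℝ (μ '' s) := by
  have h := LinearMap.IsSymmetric.orthogonal_range (T := (frameOp c μ : Vec d →ₗ[ℝ] Vec d))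
    frameOp_isSymmetric
  rw [frameOp_ker hpos hzero] at h
  have h2 := congrArg Submodule.orthogonal h
  rwa [Submodule.orthogonal_orthogonal, Submodule.orthogonal_orthogonal] at h2

lemma sigma_frameOp_pos (hpos : ∀ i ∈ s, 0 < c i) (hzero : ∀ i, i ∉ s → c i = 0) {r : ℕ}
    (hr : finrank ℝ (Submodule.span ℝ (μ '' s)) = r) (hr0 : 0 < r) :
    0 < sigma r (frameOp c μ) := by
  rw [sigma, LinearMap.singularValues_pos_iff_lt_finrank_range, frameOp_range hpos hzero, hr]
  omega

lemma sigma_frameOp_mul_le (hpos : ∀ i ∈ s, 0 < c i) (hzero : ∀ i, i ∉ s → c i = 0) {r : ℕ}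
    (hr : finrank ℝ (Submodule.span ℝ (μ '' s)) = r) {x : Vec d}
    (hx : x ∈ Submodule.span ℝ (μ '' s)) :
    sigma r (frameOp c μ) * ‖x‖ ^ 2 ≤ inner ℝ x (frameOp c μ x) := by
  refine sigma_finrank_range_mul_norm_sq_le frameOp_isSymmetric (fun y => ?_) (fun y hy => ?_) ?_
  · rw [inner_frameOp_apply]
    exact Finset.sum_nonneg fun i _ => inner_frameOp_self_nonneg hpos hzero i y
  · have hy' : y ∈ (frameOp c μ : Vec d →ₗ[ℝ] Vec d).ker := hy
    rw [frameOp_ker hpos hzero, Submodule.mem_orthogonal] at hy'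
    rw [real_inner_comm]
    exact hy' x hx
  · rw [frameOp_range hpos hzero, hr]

end FrameOperator

/-! ### The exact moments -/

/-- The facts about the exact moments `A`, `B`, `m` of a mixture on which the analysis of the
algorithm rests. `W` is the span of all means, `V` the span of the means other than `μ₁`, and `n`
the unit vector of `W` orthogonal to `V`. The numbers `sA`, `sB` bound the norms of `A`, `B`, while
`sk`, `sZ` bound the quadratic forms of `A` on `W` and of `A - l • B` on `V` from below. -/
structure MomentModel {d : ℕ} (k : ℕ) (A B : Op d) (m μ₁ n : Vec d)
    (W V : Submodule ℝ (Vec d)) (α₁ a₁ R l sA sk sB sZ : ℝ) : Prop where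
  α_pos : 0 < α₁
  α_le : α₁ ≤ 1
  a_pos : 0 < a₁
  l_pos : 0 < l
  sk_pos : 0 < sk
  sZ_pos : 0 < sZ
  sZ_le : sZ ≤ sA
  symmA : A.IsSymmetric
  symmB : B.IsSymmetric
  finrank_W : finrank ℝ W = k
  finrank_V : finrank ℝ V = k - 1
  V_le : V ≤ W
  n_mem : n ∈ W
  norm_n : ‖n‖ = 1
  n_orth : ∀ y ∈ V, inner ℝ n y = 0
  decomp : ∀ x ∈ W, V.starProjection x + inner ℝ n x • n = x
  μ_mem : μ₁ ∈ W
  inner_n_μ : inner ℝ n μ₁ = a₁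
  A_proj : ∀ x, A (W.starProjection x) = A x
  A_n : A n = (α₁ * a₁) • μ₁
  A_ge : ∀ x, α₁ * inner ℝ μ₁ x ^ 2 ≤ inner ℝ x (A x)
  A_ge_W : ∀ x ∈ W, sk * ‖x‖ ^ 2 ≤ inner ℝ x (A x)
  Z_proj : ∀ x, (A - l • B) (V.starProjection x) = (A - l • B) x
  Z_ge : ∀ x ∈ V, sZ * ‖x‖ ^ 2 ≤ inner ℝ x ((A - l • B) x)
  m_sub : m - V.starProjection m = (α₁ * a₁) • n
  norm_m : ‖m‖ ≤ R
  norm_μ : ‖μ₁‖ ≤ R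
  A_le : ∀ x, ‖A x‖ ≤ sA * ‖x‖
  B_le : ∀ x, ‖B x‖ ≤ sB * ‖x‖

/-- The moments of a mixture with linearly independent means satisfy the relations of
`MomentModel`. -/
lemma momentModel_of_mixture {d k : ℕ} [NeZero k] (α : Fin k → ℝ) (μ : Fin k → Vec d) (v : Vec d)
    {δ : ℝ} (hk : 2 ≤ k) (hα : ∀ i, 0 < α i) (hsum : ∑ i, α i = 1) (hμ : LinearIndependent ℝ μ)
    (hδ : 0 < δ) (hv : ∀ i, i ≠ 0 → (1 + δ) * inner ℝ (μ i) v ≤ inner ℝ (μ 0) v)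
    (hv0 : 0 < inner ℝ (μ 0) v)
    (hZA : sigma (k - 1) (momentA α μ - lambdaOne μ v • momentB α μ v) ≤
      sigma 1 (momentA α μ)) :
    MomentModel k (momentA α μ) (momentB α μ v) (momentM α μ) (μ 0)
      ((aOne μ)⁻¹ • (μ 0 - (Submodule.span ℝ (μ '' {i | i ≠ 0})).starProjection (μ 0)))
      (Submodule.span ℝ (μ '' Set.univ)) (Submodule.span ℝ (μ '' {i | i ≠ 0}))
      (α 0) (aOne μ) (maxNorm μ) (lambdaOne μ v) (sigma 1 (momentA α μ)) (sigma k (momentA α μ))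
      (sigma 1 (momentB α μ v))
      (sigma (k - 1) (momentA α μ - lambdaOne μ v • momentB α μ v)) := by
  set l := lambdaOne μ v with hl
  set V := Submodule.span ℝ (μ '' {i | i ≠ 0}) with hV
  set W := Submodule.span ℝ (μ '' Set.univ) with hW
  have hlpos : 0 < l := by rw [hl, lambdaOne]; positivity
  have hApos : ∀ i ∈ (Set.univ : Set (Fin k)), 0 < α i := fun i _ => hα i
  have hAzero : ∀ i, i ∉ (Set.univ : Set (Fin k)) → α i = 0 := fun i hi =>
    absurd (Set.mem_univ i) hi
  have hA : momentA α μ = frameOp α μ := rfl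
  have hB : momentB α μ v = frameOp (fun i => α i * inner ℝ (μ i) v) μ := rfl
  set c : Fin k → ℝ := fun i => α i * (1 - l * inner ℝ (μ i) v) with hc
  have hZ : momentA α μ - l • momentB α μ v = frameOp c μ := by
    rw [hA, hB, frameOp, frameOp, frameOp, Finset.smul_sum, ← Finset.sum_sub_distrib]
    refine Finset.sum_congr rfl fun i _ => ?_
    simp only [hc]
    module
  have hcpos : ∀ i ∈ {i : Fin k | i ≠ 0}, 0 < c i := by
    intro i hi
    refine mul_pos (hα i) ?_
    have h1 := hv i hi
    have h2 : inner ℝ (μ i) v < inner ℝ (μ 0) v := by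
      rcases le_or_gt (inner ℝ (μ i) v) 0 with h | h
      · exact h.trans_lt hv0
      · nlinarith [mul_pos hδ h]
    rw [hl, lambdaOne, one_div, ← div_eq_inv_mul, sub_pos, div_lt_one hv0]
    exact h2
  have hczero : ∀ i, i ∉ {i : Fin k | i ≠ 0} → c i = 0 := by
    intro i hi
    have : i = 0 := by simpa using hi
    simp only [hc, this, hl, lambdaOne, one_div_mul_cancel hv0.ne', sub_self, mul_zero]
  have hWk : finrank ℝ W = k := by
    rw [hW, Set.image_univ]
    simpa using finrank_span_eq_card hμ
  have hVk : finrank ℝ V = k - 1 := by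
    have h := finrank_span_eq_card (hμ.comp ((↑) : {i : Fin k // i ≠ 0} → Fin k)
      Subtype.val_injective)
    have h2 : Set.range (μ ∘ ((↑) : {i : Fin k // i ≠ 0} → Fin k)) = μ '' {i | i ≠ 0} := by
      rw [Set.range_comp]
      congr 1
      ext
      simp
    rw [h2] at h
    rw [hV, h]
    simp [Fintype.card_subtype_compl]
  have hVW : V ≤ W := Submodule.span_mono (Set.image_mono (Set.subset_univ _))
  have hμW : ∀ i, μ i ∈ W := fun i => Submodule.subset_span ⟨i, Set.mem_univ _, rfl⟩
  have hμV : ∀ i, i ≠ 0 → μ i ∈ V := fun i hi => Submodule.subset_span ⟨i, hi, rfl⟩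
  set a := aOne μ with ha
  have hμ0 : μ 0 ∉ V := hμ.notMem_span_image (s := {i | i ≠ 0}) (by simp)
  have hapos : 0 < a := by
    rw [ha, aOne, norm_pos_iff, sub_ne_zero]
    intro h
    exact hμ0 (Submodule.starProjection_eq_self_iff.1 h.symm)
  set n := a⁻¹ • (μ 0 - V.starProjection (μ 0)) with hn
  have han : a • n = μ 0 - V.starProjection (μ 0) := by
    rw [hn, smul_smul, mul_inv_cancel₀ hapos.ne', one_smul]
  have hnorm : ‖n‖ = 1 := by
    rw [hn, norm_smul, Real.norm_of_nonneg (inv_nonneg.2 hapos.le)]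
    exact inv_mul_cancel₀ hapos.ne'
  have hnV : ∀ y ∈ V, inner ℝ n y = 0 := by
    intro y hy
    rw [hn, inner_smul_left, real_inner_comm, inner_starProjection_sub V _ hy, mul_zero]
  have hnμ : inner ℝ n (μ 0) = a := by
    have h : μ 0 = a • n + V.starProjection (μ 0) := by rw [han]; simp
    rw [h, inner_add_right, hnV _ (Submodule.starProjection_apply_mem V _), inner_smul_right,
      real_inner_self_eq_norm_sq, hnorm]
    simp
  have hmax : ∀ i, ‖μ i‖ ≤ maxNorm μ := fun i =>
    le_ciSup (f := fun i => ‖μ i‖) (Set.finite_range _).bddAbove i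
  refine
    { α_pos := hα 0
      α_le := ?_
      a_pos := hapos
      l_pos := hlpos
      sk_pos := ?_
      sZ_pos := ?_
      sZ_le := hZA
      symmA := frameOp_isSymmetric
      symmB := frameOp_isSymmetric
      finrank_W := hWk
      finrank_V := hVk
      V_le := hVW
      n_mem := ?_
      norm_n := hnorm
      n_orth := hnV
      decomp := ?_
      μ_mem := hμW 0
      inner_n_μ := hnμ
      A_proj := frameOp_apply_starProjection hApos hAzero
      A_n := ?_
      A_ge := ?_
      A_ge_W := fun x hx => sigma_frameOp_mul_le hApos hAzero hWk hx
      Z_proj := ?_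
      Z_ge := ?_
      m_sub := ?_
      norm_m := ?_
      norm_μ := hmax 0
      A_le := norm_apply_le_sigma_one _
      B_le := norm_apply_le_sigma_one _ }
  · rw [← hsum]
    exact Finset.single_le_sum (fun i _ => (hα i).le) (Finset.mem_univ 0)
  · exact sigma_frameOp_pos hApos hAzero hWk (by omega)
  · rw [hZ]
    exact sigma_frameOp_pos hcpos hczero hVk (by omega)
  · exact W.smul_mem _ (W.sub_mem (hμW 0) (hVW (Submodule.starProjection_apply_mem V _)))
  · intro x hx
    induction hx using Submodule.span_induction with
    | mem x hx =>
      obtain ⟨i, -, rfl⟩ := hx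
      by_cases hi : i = 0
      · rw [hi, hnμ, han]
        simp
      · rw [hnV _ (hμV i hi), Submodule.starProjection_eq_self_iff.2 (hμV i hi)]
        simp
    | zero => simp
    | add x y _ _ hx hy =>
      rw [map_add, inner_add_right, add_smul]
      nth_rewrite 3 [← hx]
      nth_rewrite 3 [← hy]
      abel
    | smul c x _ hx =>
      rw [map_smul, inner_smul_right, mul_smul, ← smul_add, hx]
  · rw [hA, frameOp_apply, Finset.sum_eq_single 0]
    · rw [real_inner_comm, hnμ]
    · intro i _ hi
      rw [real_inner_comm, hnV _ (hμV i hi), mul_zero, zero_smul]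
    · simp
  · intro x
    rw [hA, inner_frameOp_apply, sq, ← mul_assoc]
    exact Finset.single_le_sum (f := fun i => α i * inner ℝ (μ i) x * inner ℝ (μ i) x)
      (fun i _ => inner_frameOp_self_nonneg hApos hAzero i x) (Finset.mem_univ 0)
  · intro x
    rw [hZ]
    exact frameOp_apply_starProjection hcpos hczero x
  · intro x hx
    rw [hZ]
    exact sigma_frameOp_mul_le hcpos hczero hVk hx
  · rw [momentM, map_sum, ← Finset.sum_sub_distrib, Finset.sum_eq_single 0]
    · rw [map_smul, ← smul_sub, mul_smul, han]
    · intro i _ hi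
      rw [map_smul, Submodule.starProjection_eq_self_iff.2 (hμV i hi), sub_self]
    · simp
  · calc ‖momentM α μ‖ ≤ ∑ i, ‖α i • μ i‖ := norm_sum_le _ _
      _ ≤ ∑ i, α i * maxNorm μ := by
        refine Finset.sum_le_sum fun i _ => ?_
        rw [norm_smul, Real.norm_of_nonneg (hα i).le]
        exact mul_le_mul_of_nonneg_left (hmax i) (hα i).le
      _ = maxNorm μ := by rw [← Finset.sum_mul, hsum, one_mul]

/-! ### Perturbed quadratic forms -/

/-- The compression of a symmetric operator to a subspace is positive semidefinite iff its
quadratic form is nonnegative on that subspace. -/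
lemma isPositive_compression_iff {d : ℕ} {T : Op d} (hT : T.IsSymmetric)
    (U : Submodule ℝ (Vec d)) :
    (U.starProjection ∘L T ∘L U.starProjection).IsPositive ↔ ∀ x ∈ U, 0 ≤ inner ℝ x (T x) := by
  have hUs : ∀ x y, inner ℝ (U.starProjection x) y = inner ℝ x (U.starProjection y) :=
    fun x y => Submodule.inner_starProjection_left_eq_right U x y
  constructor
  · rintro ⟨-, h⟩ x hx
    have h1 := h x
    simp only [ContinuousLinearMap.reApplyInnerSelf_apply, ContinuousLinearMap.comp_apply,
      RCLike.re_to_real] at h1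
    rwa [hUs, Submodule.starProjection_eq_self_iff.2 hx, real_inner_comm] at h1
  · intro h
    refine ⟨fun x y => ?_, fun x => ?_⟩
    · change inner ℝ (U.starProjection (T (U.starProjection x))) y
        = inner ℝ x (U.starProjection (T (U.starProjection y)))
      rw [hUs, ← hUs x]
      exact hT _ _
    · simp only [ContinuousLinearMap.reApplyInnerSelf_apply, ContinuousLinearMap.comp_apply,
        RCLike.re_to_real]
      rw [hUs, real_inner_comm]
      exact h _ (Submodule.starProjection_apply_mem U x)

lemma isSymmetric_sub_smul {d : ℕ} {A B : Op d} (hA : A.IsSymmetric) (hB : B.IsSymmetric)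
    (t : ℝ) : (A - t • B).IsSymmetric := by
  intro x y
  have h1 : inner ℝ (A x) y = inner ℝ x (A y) := hA x y
  have h2 : inner ℝ (B x) y = inner ℝ x (B y) := hB x y
  simp [inner_sub_left, inner_sub_right, inner_smul_left, inner_smul_right, h1, h2]

lemma abs_inner_sub_le {d : ℕ} {T T' : Op d} {e : ℝ} (h : ∀ x, ‖T x - T' x‖ ≤ e * ‖x‖)
    (x : Vec d) : |inner ℝ x (T x) - inner ℝ x (T' x)| ≤ e * ‖x‖ ^ 2 := by
  rw [← inner_sub_right]
  calc _ ≤ ‖x‖ * ‖T x - T' x‖ := abs_real_inner_le_norm _ _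
    _ ≤ ‖x‖ * (e * ‖x‖) := mul_le_mul_of_nonneg_left (h x) (norm_nonneg _)
    _ = _ := by ring

/-- If every vector of `U` is close to `S`, then vectors orthogonal to `S` are nearly orthogonal
to `U`. -/
lemma norm_starProjection_le_of_orthogonal {F : Type*} [NormedAddCommGroup F]
    [InnerProductSpace ℝ F] [FiniteDimensional ℝ F] {U S : Submodule ℝ F} {θ : ℝ} (hθ : 0 ≤ θ)
    (h : ∀ x ∈ U, ‖x - S.starProjection x‖ ≤ θ * ‖x‖) {z : F} (hz : ∀ y ∈ S, inner ℝ y z = 0) :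
    ‖U.starProjection z‖ ≤ θ * ‖z‖ := by
  set w := U.starProjection z with hw
  have hwU : w ∈ U := Submodule.starProjection_apply_mem U z
  have h1 : ‖w‖ ^ 2 = inner ℝ (w - S.starProjection w) z := by
    rw [inner_sub_left, hz _ (Submodule.starProjection_apply_mem S w), sub_zero,
      ← real_inner_self_eq_norm_sq]
    nth_rewrite 2 [hw]
    rw [← sub_eq_zero, ← inner_sub_right, ← neg_eq_zero, ← inner_neg_right, neg_sub]
    exact inner_starProjection_sub U z hwU
  have h2 : ‖w‖ ^ 2 ≤ θ * ‖w‖ * ‖z‖ := by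
    rw [h1]
    exact (real_inner_le_norm _ _).trans (mul_le_mul_of_nonneg_right (h w hwU) (norm_nonneg _))
  rcases (norm_nonneg w).eq_or_lt with h0 | h0
  · rw [← h0]
    positivity
  · refine le_of_mul_le_mul_left ?_ h0
    nlinarith

/-! ### Structure of the exact moments -/

namespace MomentModel

variable {d k : ℕ} {A B : Op d} {m μ₁ n : Vec d} {W V : Submodule ℝ (Vec d)}
  {α₁ a₁ R l sA sk sB sZ : ℝ}

lemma a_le_norm (h : MomentModel k A B m μ₁ n W V α₁ a₁ R l sA sk sB sZ) : a₁ ≤ ‖μ₁‖ := by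
  have := real_inner_le_norm n μ₁
  rwa [h.inner_n_μ, h.norm_n, one_mul] at this

lemma norm_pos (h : MomentModel k A B m μ₁ n W V α₁ a₁ R l sA sk sB sZ) : 0 < ‖μ₁‖ :=
  h.a_pos.trans_le h.a_le_norm

lemma α_mul_norm_sq_le (h : MomentModel k A B m μ₁ n W V α₁ a₁ R l sA sk sB sZ) :
    α₁ * ‖μ₁‖ ^ 2 ≤ sA := by
  have h1 := h.A_ge μ₁
  rw [real_inner_self_eq_norm_sq] at h1
  have h2 : inner ℝ μ₁ (A μ₁) ≤ ‖μ₁‖ * (sA * ‖μ₁‖) :=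
    (real_inner_le_norm _ _).trans (mul_le_mul_of_nonneg_left (h.A_le _) (norm_nonneg _))
  have h3 : 0 < ‖μ₁‖ ^ 2 := pow_pos h.norm_pos 2
  refine le_of_mul_le_mul_right ?_ h3
  nlinarith

lemma starProjection_n (h : MomentModel k A B m μ₁ n W V α₁ a₁ R l sA sk sB sZ) :
    V.starProjection n = 0 := by
  refine Submodule.eq_starProjection_of_mem_of_inner_eq_zero V.zero_mem fun w hw => ?_
  rw [sub_zero]
  exact h.n_orth w hw

lemma starProjection_comp (h : MomentModel k A B m μ₁ n W V α₁ a₁ R l sA sk sB sZ) (x : Vec d) :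
    V.starProjection (W.starProjection x) = V.starProjection x := by
  refine Submodule.eq_starProjection_of_mem_of_inner_eq_zero
    (Submodule.starProjection_apply_mem V x) fun w hw => ?_
  have h1 := inner_starProjection_sub V x hw
  have h2 := inner_starProjection_sub W x (h.V_le hw)
  rw [inner_sub_right] at h1 h2
  rw [real_inner_comm, inner_sub_right]
  linarith

lemma inner_n_starProjection (h : MomentModel k A B m μ₁ n W V α₁ a₁ R l sA sk sB sZ)
    (x : Vec d) : inner ℝ n (W.starProjection x) = inner ℝ n x := by
  have h2 := inner_starProjection_sub W x h.n_mem
  rw [inner_sub_right] at h2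
  linarith

lemma starProjection_W_eq (h : MomentModel k A B m μ₁ n W V α₁ a₁ R l sA sk sB sZ)
    (x : Vec d) : W.starProjection x = V.starProjection x + inner ℝ n x • n := by
  have h1 := h.decomp _ (Submodule.starProjection_apply_mem W x)
  rw [h.starProjection_comp, h.inner_n_starProjection] at h1
  exact h1.symm

lemma apply_mem_of_proj {T : Op d} (hT : T.IsSymmetric) {S : Submodule ℝ (Vec d)}
    (hS : ∀ x, T (S.starProjection x) = T x) (x : Vec d) : T x ∈ S := by
  rw [← Submodule.orthogonal_orthogonal S, Submodule.mem_orthogonal]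
  intro y hy
  have h1 : S.starProjection y = 0 := by
    refine Submodule.eq_starProjection_of_mem_of_inner_eq_zero S.zero_mem fun w hw => ?_
    rw [sub_zero]
    exact Submodule.inner_left_of_mem_orthogonal hw hy
  have h2 : T y = 0 := by rw [← hS, h1, map_zero]
  have h3 : inner ℝ (T y) x = inner ℝ y (T x) := hT _ _
  rw [← h3, h2, inner_zero_left]

lemma A_mem (h : MomentModel k A B m μ₁ n W V α₁ a₁ R l sA sk sB sZ) (x : Vec d) : A x ∈ W :=
  apply_mem_of_proj h.symmA h.A_proj x

lemma Z_mem (h : MomentModel k A B m μ₁ n W V α₁ a₁ R l sA sk sB sZ) (x : Vec d) :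
    (A - l • B) x ∈ V :=
  apply_mem_of_proj (isSymmetric_sub_smul h.symmA h.symmB l) h.Z_proj x

lemma A_sub_proj (h : MomentModel k A B m μ₁ n W V α₁ a₁ R l sA sk sB sZ) (x : Vec d) :
    A x - V.starProjection (A x) = (α₁ * a₁ * inner ℝ μ₁ x) • n := by
  have h1 := h.decomp _ (h.A_mem x)
  have h2 : inner ℝ (A n) x = inner ℝ n (A x) := h.symmA _ _
  rw [h.A_n, inner_smul_left] at h2
  rw [← h2] at h1
  rw [sub_eq_iff_eq_add']
  exact h1.symm

/-- The part of `B` that leaves `V` has rank one and is controlled by `μ₁` alone, since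
`l B = A - Z` and `Z` maps into `V`. -/
lemma B_sub_proj_le (h : MomentModel k A B m μ₁ n W V α₁ a₁ R l sA sk sB sZ) (x : Vec d) :
    l * ‖B x - V.starProjection (B x)‖ ≤ α₁ * a₁ * ‖μ₁‖ * ‖x‖ := by
  have h1 : l • (B x - V.starProjection (B x)) = A x - V.starProjection (A x) := by
    have h2 : V.starProjection ((A - l • B) x) = (A - l • B) x :=
      Submodule.starProjection_eq_self_iff.2 (h.Z_mem x)
    simp only [_root_.sub_apply, _root_.smul_apply, map_sub, map_smul] at h2
    rw [smul_sub, ← sub_eq_zero]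
    rw [← sub_eq_zero] at h2
    refine Eq.trans ?_ h2
    module
  have h3 : l * ‖B x - V.starProjection (B x)‖ = ‖A x - V.starProjection (A x)‖ := by
    rw [← h1, norm_smul, Real.norm_of_nonneg h.l_pos.le]
  rw [h3, h.A_sub_proj, norm_smul, h.norm_n, mul_one, Real.norm_eq_abs, abs_mul,
    abs_of_pos (mul_pos h.α_pos h.a_pos), mul_assoc (α₁ * a₁)]
  exact mul_le_mul_of_nonneg_left (abs_real_inner_le_norm _ _)
    (mul_pos h.α_pos h.a_pos).le

lemma Z_inner_ge (h : MomentModel k A B m μ₁ n W V α₁ a₁ R l sA sk sB sZ) (x : Vec d) :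
    sZ * ‖V.starProjection x‖ ^ 2 ≤ inner ℝ x ((A - l • B) x) := by
  have hs := isSymmetric_sub_smul h.symmA h.symmB l
  have h1 : inner ℝ x ((A - l • B) x)
      = inner ℝ (V.starProjection x) ((A - l • B) (V.starProjection x)) := by
    have h2 : ∀ y z, inner ℝ ((A - l • B) y) z = inner ℝ y ((A - l • B) z) := fun y z => hs y z
    rw [← h.Z_proj x, ← h2, ← h2, h.Z_proj x]
  rw [h1]
  exact h.Z_ge _ (Submodule.starProjection_apply_mem V x)

lemma inner_pencil (A B : Op d) (l t : ℝ) (x : Vec d) :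
    inner ℝ x ((A - (l * (1 - t)) • B) x) =
      t * inner ℝ x (A x) + (1 - t) * inner ℝ x ((A - l • B) x) := by
  simp only [_root_.sub_apply, _root_.smul_apply, inner_sub_right, inner_smul_right]
  ring

/-- On vectors whose projection to `W` is the unit normal `n`, the quadratic form of `A - λ B`
is known exactly; it changes sign at `λ = l`. -/
lemma inner_pencil_eq (h : MomentModel k A B m μ₁ n W V α₁ a₁ R l sA sk sB sZ) (t : ℝ) {x : Vec d}
    (hx : W.starProjection x = n) :
    inner ℝ x ((A - (l * (1 - t)) • B) x) = t * (α₁ * a₁ ^ 2) := by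
  have hV : V.starProjection x = 0 := by
    rw [← h.starProjection_comp, hx, h.starProjection_n]
  have hn : inner ℝ n x = 1 := by
    rw [← h.inner_n_starProjection, hx, real_inner_self_eq_norm_sq, h.norm_n, one_pow]
  have hA : inner ℝ x (A x) = α₁ * a₁ ^ 2 := by
    rw [← h.A_proj x, hx, h.A_n, inner_smul_right]
    have h2 := inner_starProjection_sub W x h.μ_mem
    rw [hx, inner_sub_right, sub_eq_zero] at h2
    rw [real_inner_comm, h2, real_inner_comm, h.inner_n_μ]
    ring
  rw [inner_pencil, hA, ← h.Z_proj x, hV, map_zero, inner_zero_right]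
  ring

/-- For `λ = l (1 - t)` slightly below `l`, the quadratic form of `A - λ B` is bounded from below on
the component along `n` by the contribution `t ⟨x, A x⟩`, and on the component in `V` by `Z`. -/
lemma inner_pencil_ge (h : MomentModel k A B m μ₁ n W V α₁ a₁ R l sA sk sB sZ) {t : ℝ}
    (ht0 : 0 ≤ t) (ht : t ≤ 1 / 2) (htR : t * (α₁ * R ^ 2) ≤ sZ / 4) (x : Vec d) :
    t * (α₁ * a₁ ^ 2) / 2 * inner ℝ n x ^ 2 + sZ / 4 * ‖V.starProjection x‖ ^ 2 ≤
      inner ℝ x ((A - (l * (1 - t)) • B) x) := by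
  rw [inner_pencil]
  have h1 := h.A_ge (W.starProjection x)
  have hA : inner ℝ (W.starProjection x) (A (W.starProjection x)) = inner ℝ x (A x) := by
    have hs : ∀ y z, inner ℝ (A y) z = inner ℝ y (A z) := fun y z => h.symmA y z
    rw [← hs, h.A_proj, hs, h.A_proj]
  rw [hA] at h1
  have h2 := h.Z_inner_ge x
  have h3 : inner ℝ μ₁ (W.starProjection x)
      = inner ℝ n x * a₁ + inner ℝ μ₁ (V.starProjection x) := by
    rw [h.starProjection_W_eq, inner_add_right, inner_smul_right, real_inner_comm n μ₁,
      h.inner_n_μ, add_comm]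
  rw [h3] at h1
  set p := inner ℝ μ₁ (V.starProjection x) with hp
  set s := inner ℝ n x
  set y := ‖V.starProjection x‖ with hy
  have h4 : p ^ 2 ≤ R ^ 2 * y ^ 2 := by
    rw [← mul_pow, ← sq_abs]
    refine pow_le_pow_left₀ (abs_nonneg _) ?_ 2
    exact (abs_real_inner_le_norm _ _).trans
      (mul_le_mul_of_nonneg_right h.norm_μ (norm_nonneg _))
  -- `(p + q)² ≥ p² / 2 - q²`
  have h5 : s ^ 2 * a₁ ^ 2 / 2 - R ^ 2 * y ^ 2 ≤ (s * a₁ + p) ^ 2 := by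
    nlinarith [sq_nonneg (s * a₁ + 2 * p)]
  have h6 : t * (α₁ * (s ^ 2 * a₁ ^ 2 / 2 - R ^ 2 * y ^ 2)) ≤ t * inner ℝ x (A x) :=
    mul_le_mul_of_nonneg_left ((mul_le_mul_of_nonneg_left h5 h.α_pos.le).trans h1) ht0
  have h7 : 1 / 2 * (sZ * y ^ 2) ≤ (1 - t) * inner ℝ x ((A - l • B) x) := by
    have h8 : 0 ≤ sZ * y ^ 2 := mul_nonneg h.sZ_pos.le (sq_nonneg _)
    exact mul_le_mul (by linarith) h2 h8 (by linarith)
  have h9 : t * (α₁ * R ^ 2) * y ^ 2 ≤ sZ / 4 * y ^ 2 :=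
    mul_le_mul_of_nonneg_right htR (sq_nonneg _)
  nlinarith

/-! ### Line search and angle error -/

variable {ε : ℝ} {Ahat Bhat : Op d}

/-- The top eigenspace of the perturbed second moment is close to the span of the means. -/
lemma close_W (h : MomentModel k A B m μ₁ n W V α₁ a₁ R l sA sk sB sZ) (hε : ε ≤ sk / 4)
    (hAs : Ahat.IsSymmetric) (hA : ∀ x, ‖Ahat x - A x‖ ≤ ε * ‖x‖) {u : Fin k → Vec d}
    (hu : IsTopEigenvectors Ahat u) {x : Vec d} (hx : x ∈ Submodule.span ℝ (Set.range u)) :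
    ‖x - W.starProjection x‖ ≤ 1 / 2 * ‖x‖ := by
  have hsk := h.sk_pos
  obtain ⟨e, he, hce⟩ := hu.exists_eigenvalues hAs h.finrank_W (c := sk / 2) (fun y hy => by
    have h1 := h.A_ge_W y hy
    have h2 := (abs_le.1 (abs_inner_sub_le hA y)).1
    nlinarith [sq_nonneg ‖y‖])
  obtain ⟨y, rfl, hy⟩ := exists_preimage_of_mem_span hu.1 he (half_pos hsk) hce hx
  -- `A` maps into `W`, so only the perturbation contributes to the distance from `W`
  calc _ ≤ ‖Ahat y - A y‖ := norm_sub_starProjection_le_norm_sub W _ (h.A_mem y)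
    _ ≤ ε * ‖y‖ := hA y
    _ ≤ sk / 4 * ‖y‖ := mul_le_mul_of_nonneg_right hε (norm_nonneg _)
    _ ≤ 1 / 2 * ‖Ahat y‖ := by linarith

/-- Perturbation of the pencil `A - t B` in operator norm. -/
lemma norm_pencil_sub_le (hA : ∀ x, ‖Ahat x - A x‖ ≤ ε * ‖x‖)
    (hB : ∀ x, ‖Bhat x - B x‖ ≤ ε * ‖x‖) (t : ℝ) (x : Vec d) :
    ‖(Ahat - t • Bhat) x - (A - t • B) x‖ ≤ ε * (1 + |t|) * ‖x‖ := by
  have h1 : (Ahat - t • Bhat) x - (A - t • B) x = (Ahat x - A x) - t • (Bhat x - B x) := by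
    simp only [_root_.sub_apply, _root_.smul_apply]
    module
  rw [h1]
  calc _ ≤ ‖Ahat x - A x‖ + ‖t • (Bhat x - B x)‖ := norm_sub_le _ _
    _ ≤ ε * ‖x‖ + |t| * (ε * ‖x‖) := by
      rw [norm_smul, Real.norm_eq_abs]
      exact add_le_add (hA x) (mul_le_mul_of_nonneg_left (hB x) (abs_nonneg _))
    _ = _ := by ring

/-- Every `λ` for which the compressed pencil is positive semidefinite is at most slightly larger
than `l`. -/
lemma lam_le (h : MomentModel k A B m μ₁ n W V α₁ a₁ R l sA sk sB sZ) (hε0 : 0 ≤ ε)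
    (hA : ∀ x, ‖Ahat x - A x‖ ≤ ε * ‖x‖) (hB : ∀ x, ‖Bhat x - B x‖ ≤ ε * ‖x‖)
    {U : Submodule ℝ (Vec d)} (hdim : finrank ℝ U = k)
    (hU : ∀ x ∈ U, ‖x - W.starProjection x‖ ≤ 1 / 2 * ‖x‖)
    {t₀ : ℝ} (ht₀ : t₀ * (α₁ * a₁ ^ 2) = 4 * ε * (1 + l)) (ht : t₀ ≤ 1 / 2) {lam : ℝ}
    (hlam : ∀ x ∈ U, 0 ≤ inner ℝ x ((Ahat - lam • Bhat) x)) : lam ≤ l * (1 + t₀) := by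
  obtain ⟨x, hxU, hx⟩ := exists_mem_starProjection_eq (hdim.trans h.finrank_W.symm) le_rfl hU
    h.n_mem
  have hx2 := norm_sq_le_two_mul_of_close le_rfl hU hxU
  rw [hx, h.norm_n] at hx2
  have hl := h.l_pos
  have hc : 0 < α₁ * a₁ ^ 2 := mul_pos h.α_pos (pow_pos h.a_pos 2)
  have ht₀' : 0 ≤ t₀ := by
    refine nonneg_of_mul_nonneg_left (b := α₁ * a₁ ^ 2) ?_ hc
    rw [ht₀]
    positivity
  by_contra! hlt
  obtain ⟨t, rfl⟩ : ∃ t, lam = l * (1 - t) := ⟨1 - lam / l, by field_simp; ring⟩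
  have htt : t₀ < -t := by
    have := lt_of_mul_lt_mul_left hlt hl.le
    linarith
  have h1 := h.inner_pencil_eq t hx
  have h2 := hlam x hxU
  have h3 := (abs_le.1 (abs_inner_sub_le (norm_pencil_sub_le hA hB (l * (1 - t))) x)).2
  rw [abs_of_nonneg (mul_nonneg hl.le (by linarith))] at h3
  have h4 : ε * (1 + l * (1 - t)) * ‖x‖ ^ 2 ≤ ε * (1 + l * (1 - t)) * 2 := by
    refine mul_le_mul_of_nonneg_left (by linarith) (mul_nonneg hε0 ?_)
    have : 0 ≤ l * (1 - t) := mul_nonneg hl.le (by linarith)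
    linarith
  -- `|t| α₁ a₁² ≤ 2 ε (1 + l) + 2 ε l |t|`, and the last term is at most half of the left side
  have h5 : -t * (α₁ * a₁ ^ 2) ≤ 2 * ε * (1 + l) + 2 * ε * l * -t := by linarith
  have h6 : 4 * ε * l ≤ (α₁ * a₁ ^ 2) / 2 := by nlinarith
  have h7 : 2 * ε * l * -t ≤ (α₁ * a₁ ^ 2) / 4 * -t :=
    mul_le_mul_of_nonneg_right (by linarith) (by linarith)
  nlinarith [mul_lt_mul_of_pos_right htt hc, mul_nonneg hε0 hl.le]

/-- Slightly below `l` the compressed pencil is positive semidefinite. -/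
lemma pencil_nonneg (h : MomentModel k A B m μ₁ n W V α₁ a₁ R l sA sk sB sZ) (hε0 : 0 ≤ ε)
    (hA : ∀ x, ‖Ahat x - A x‖ ≤ ε * ‖x‖) (hB : ∀ x, ‖Bhat x - B x‖ ≤ ε * ‖x‖)
    {U : Submodule ℝ (Vec d)} (hU : ∀ x ∈ U, ‖x - W.starProjection x‖ ≤ 1 / 2 * ‖x‖)
    {t₀ : ℝ} (ht₀ : t₀ * (α₁ * a₁ ^ 2) = 4 * ε * (1 + l)) (ht : t₀ ≤ 1 / 2)
    (htR : t₀ * (α₁ * R ^ 2) ≤ sZ / 4) (hεZ : 2 * ε * (1 + l) ≤ sZ / 4) :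
    ∀ x ∈ U, 0 ≤ inner ℝ x ((Ahat - (l * (1 - t₀)) • Bhat) x) := by
  intro x hx
  have hl := h.l_pos
  have hc : 0 < α₁ * a₁ ^ 2 := mul_pos h.α_pos (pow_pos h.a_pos 2)
  have ht₀' : 0 ≤ t₀ := by
    refine nonneg_of_mul_nonneg_left (b := α₁ * a₁ ^ 2) ?_ hc
    rw [ht₀]
    positivity
  have hx2 := norm_sq_le_two_mul_of_close le_rfl hU hx
  have h1 := h.inner_pencil_ge ht₀' ht htR x
  have h3 := (abs_le.1 (abs_inner_sub_le (norm_pencil_sub_le hA hB (l * (1 - t₀))) x)).1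
  rw [abs_of_nonneg (mul_nonneg hl.le (by linarith))] at h3
  have hW : ‖W.starProjection x‖ ^ 2 = ‖V.starProjection x‖ ^ 2 + inner ℝ n x ^ 2 := by
    rw [h.starProjection_W_eq, ← real_inner_self_eq_norm_sq]
    have h4 : inner ℝ n (V.starProjection x) = 0 :=
      h.n_orth _ (Submodule.starProjection_apply_mem V x)
    have h5 : inner ℝ (V.starProjection x) n = 0 := by rw [real_inner_comm, h4]
    simp only [inner_add_left, inner_add_right, inner_smul_left, inner_smul_right, h4, h5,
      real_inner_self_eq_norm_sq, h.norm_n]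
    simp
    ring
  rw [hW] at hx2
  have h6 : ε * (1 + l * (1 - t₀)) * ‖x‖ ^ 2 ≤
      ε * (1 + l) * (2 * (‖V.starProjection x‖ ^ 2 + inner ℝ n x ^ 2)) := by
    refine mul_le_mul (mul_le_mul_of_nonneg_left ?_ hε0) hx2 (sq_nonneg _) (by positivity)
    nlinarith
  have h7 : 2 * ε * (1 + l) * ‖V.starProjection x‖ ^ 2 ≤ sZ / 4 * ‖V.starProjection x‖ ^ 2 :=
    mul_le_mul_of_nonneg_right hεZ (sq_nonneg _)
  have h8 : t₀ * (α₁ * a₁ ^ 2) / 2 * inner ℝ n x ^ 2 = 2 * ε * (1 + l) * inner ℝ n x ^ 2 := by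
    rw [ht₀]; ring
  nlinarith

/-- The span of the top singular vectors of the perturbed pencil at `lam` is close to `V`. The
error in `lam` enters only through the component of `B` that leaves `V`, so `sB` does not appear
in the bound. -/
lemma close_V (h : MomentModel k A B m μ₁ n W V α₁ a₁ R l sA sk sB sZ) (hε0 : 0 ≤ ε)
    (hA : ∀ x, ‖Ahat x - A x‖ ≤ ε * ‖x‖) (hB : ∀ x, ‖Bhat x - B x‖ ≤ ε * ‖x‖)
    (hAs : Ahat.IsSymmetric) (hBs : Bhat.IsSymmetric)
    {t₀ : ℝ} (ht₀ : t₀ * (α₁ * a₁ ^ 2) = 4 * ε * (1 + l)) (ht : t₀ ≤ 1 / 2)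
    (hη : ε * (1 + 2 * l) + l * t₀ * sB ≤ sZ / 2)
    {lam : ℝ} (hlam : |lam - l| ≤ l * t₀) {u : Fin (k - 1) → Vec d}
    (hu : IsTopSingularVectors (Ahat - lam • Bhat) u) {x : Vec d}
    (hx : x ∈ Submodule.span ℝ (Set.range u)) :
    ‖x - V.starProjection x‖ ≤ 12 * ε * (1 + l) * ‖μ₁‖ / (a₁ * sZ) * ‖x‖ := by
  have hl := h.l_pos
  have ha := h.a_pos
  have hα := h.α_pos
  have hsZ := h.sZ_pos
  set Zh := Ahat - lam • Bhat with hZh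
  have hZs : ∀ y z, inner ℝ (Zh y) z = inner ℝ y (Zh z) :=
    fun y z => isSymmetric_sub_smul hAs hBs lam y z
  have hadj : ContinuousLinearMap.adjoint Zh = Zh :=
    (ContinuousLinearMap.isSelfAdjoint_iff_isSymmetric.2 (isSymmetric_sub_smul hAs hBs lam))
  have hlam2 : |lam| ≤ 2 * l := by
    have h1 : |lam| ≤ |lam - l| + |l| := by
      simpa using abs_add_le (lam - l) l
    rw [abs_of_pos hl] at h1
    nlinarith
  have hsplit : ∀ y, Zh y - (A - l • B) y =
      (Zh y - (A - lam • B) y) - (lam - l) • B y := by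
    intro y
    simp only [_root_.sub_apply, _root_.smul_apply]
    module
  have hp1 : ∀ y, ‖Zh y - (A - lam • B) y‖ ≤ ε * (1 + 2 * l) * ‖y‖ := by
    intro y
    refine (norm_pencil_sub_le hA hB lam y).trans ?_
    refine mul_le_mul_of_nonneg_right ?_ (norm_nonneg _)
    exact mul_le_mul_of_nonneg_left (by linarith) hε0
  have hp2 : ∀ y, ‖Zh y - (A - l • B) y‖ ≤ sZ / 2 * ‖y‖ := by
    intro y
    rw [hsplit]
    calc _ ≤ ε * (1 + 2 * l) * ‖y‖ + ‖(lam - l) • B y‖ :=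
        (norm_sub_le _ _).trans (add_le_add (hp1 y) le_rfl)
      _ ≤ ε * (1 + 2 * l) * ‖y‖ + l * t₀ * (sB * ‖y‖) := by
        rw [norm_smul, Real.norm_eq_abs]
        gcongr
        · exact (abs_nonneg _).trans hlam
        · exact h.B_le y
      _ = (ε * (1 + 2 * l) + l * t₀ * sB) * ‖y‖ := by ring
      _ ≤ _ := mul_le_mul_of_nonneg_right hη (norm_nonneg _)
  set ρ := 6 * ε * (1 + l) * ‖μ₁‖ / a₁ with hρ
  have hρa : ρ * a₁ = 6 * ε * (1 + l) * ‖μ₁‖ := by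
    rw [hρ, div_mul_cancel₀ _ ha.ne']
  have hp3 : ∀ y, ‖(Zh y - (A - l • B) y) - V.starProjection (Zh y - (A - l • B) y)‖
      ≤ ρ * ‖y‖ := by
    intro y
    have h1 : (Zh y - (A - l • B) y) - V.starProjection (Zh y - (A - l • B) y) =
        ((Zh y - (A - lam • B) y) - V.starProjection (Zh y - (A - lam • B) y)) -
          (lam - l) • (B y - V.starProjection (B y)) := by
      rw [hsplit, map_sub, map_smul]
      module
    rw [h1]
    have h2 : ‖(lam - l) • (B y - V.starProjection (B y))‖ ≤ t₀ * (α₁ * a₁ * ‖μ₁‖ * ‖y‖) := by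
      rw [norm_smul, Real.norm_eq_abs]
      have h3 := h.B_sub_proj_le y
      have h4 : 0 ≤ t₀ := nonneg_of_mul_nonneg_right ((abs_nonneg _).trans hlam) hl
      calc |lam - l| * ‖B y - V.starProjection (B y)‖
          ≤ l * t₀ * ‖B y - V.starProjection (B y)‖ :=
            mul_le_mul_of_nonneg_right hlam (norm_nonneg _)
        _ = t₀ * (l * ‖B y - V.starProjection (B y)‖) := by ring
        _ ≤ _ := mul_le_mul_of_nonneg_left h3 h4
    have h5 : ε * (1 + 2 * l) * a₁ ≤ 2 * ε * (1 + l) * ‖μ₁‖ := by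
      refine mul_le_mul (by nlinarith) h.a_le_norm ha.le (by positivity)
    have h6 : (ε * (1 + 2 * l) + t₀ * (α₁ * a₁ * ‖μ₁‖)) ≤ ρ := by
      refine le_of_mul_le_mul_right ?_ ha
      rw [hρa]
      have : t₀ * (α₁ * a₁ * ‖μ₁‖) * a₁ = 4 * ε * (1 + l) * ‖μ₁‖ := by
        rw [← ht₀]; ring
      rw [add_mul, this]
      linarith
    calc _ ≤ ε * (1 + 2 * l) * ‖y‖ + t₀ * (α₁ * a₁ * ‖μ₁‖ * ‖y‖) :=
        (norm_sub_le _ _).trans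
          (add_le_add ((norm_sub_starProjection_le V _).trans (hp1 y)) h2)
      _ = (ε * (1 + 2 * l) + t₀ * (α₁ * a₁ * ‖μ₁‖)) * ‖y‖ := by ring
      _ ≤ _ := mul_le_mul_of_nonneg_right h6 (norm_nonneg _)
  have hT : ∀ y z, inner ℝ y ((ContinuousLinearMap.adjoint Zh ∘L Zh) z)
      = inner ℝ (Zh y) (Zh z) := by
    intro y z
    rw [ContinuousLinearMap.comp_apply, ContinuousLinearMap.adjoint_inner_right]
  have hTs : (ContinuousLinearMap.adjoint Zh ∘L Zh).IsSymmetric := by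
    intro y z
    change inner ℝ ((ContinuousLinearMap.adjoint Zh ∘L Zh) y) z
      = inner ℝ y ((ContinuousLinearMap.adjoint Zh ∘L Zh) z)
    rw [real_inner_comm, hT, hT, real_inner_comm]
  obtain ⟨e, he, hce⟩ := IsTopEigenvectors.exists_eigenvalues hTs hu h.finrank_V
    (c := (sZ / 2) ^ 2) (fun y hy => by
      rw [hT, real_inner_self_eq_norm_sq, ← mul_pow]
      refine pow_le_pow_left₀ (by positivity) ?_ 2
      have h1 : sZ * ‖y‖ ≤ ‖(A - l • B) y‖ := by
        rcases (norm_nonneg y).eq_or_lt with h0 | h0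
        · rw [← h0, mul_zero]
          exact norm_nonneg _
        · refine le_of_mul_le_mul_left ?_ h0
          have h2 := h.Z_ge y hy
          have h3 := real_inner_le_norm y ((A - l • B) y)
          nlinarith
      have h2 := norm_sub_norm_le ((A - l • B) y) (Zh y)
      rw [norm_sub_rev] at h2
      have h3 := hp2 y
      linarith)
  obtain ⟨y, hyx, hy⟩ := exists_preimage_of_mem_span hu.1 he (by positivity) hce hx
  -- `x = Zh z` with `z = Zh y`
  set z := Zh y with hz
  have hzx : Zh z = x := by
    rw [← hyx, ContinuousLinearMap.comp_apply, hadj]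
  have hznorm : sZ / 2 * ‖z‖ ≤ ‖x‖ := by
    refine le_of_sq_le_sq ?_ (norm_nonneg _)
    have h1 : ‖z‖ ^ 2 = inner ℝ y x := by
      rw [← hyx, hT, real_inner_self_eq_norm_sq]
    have h2 := real_inner_le_norm y x
    have h3 : (sZ / 2) ^ 2 * ‖y‖ * ‖x‖ ≤ ‖x‖ * ‖x‖ :=
      mul_le_mul_of_nonneg_right hy (norm_nonneg _)
    rw [mul_pow, h1]
    nlinarith [sq_nonneg (sZ / 2)]
  have hfin : ‖x - V.starProjection x‖ ≤ ρ * ‖z‖ := by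
    have h1 := hp3 z
    have h2 : V.starProjection ((A - l • B) z) = (A - l • B) z :=
      Submodule.starProjection_eq_self_iff.2 (h.Z_mem z)
    rwa [map_sub, h2, sub_sub_sub_cancel_right, hzx] at h1
  have hρ0 : 0 ≤ ρ := by positivity
  calc _ ≤ ρ * ‖z‖ := hfin
    _ ≤ ρ * (‖x‖ / (sZ / 2)) := by
      refine mul_le_mul_of_nonneg_left ?_ hρ0
      rw [le_div_iff₀ (by positivity)]
      linarith
    _ = _ := by
      rw [hρ]
      field_simp
      ring

end MomentModel

/-! ### Output stage -/

/-- The data entering the output stage: a subspace `U` (the span of the tail vectors) within angle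
error `θ` of `V`, and a unit vector `w` orthogonal to `U` such that `r • w` (the residual of `m̂`)
is within `τ` of its exact value `α₁ a₁ n`. -/
structure OutputData {d : ℕ} (n : Vec d) (U V : Submodule ℝ (Vec d)) (θ τ α₁ a₁ r : ℝ) (w : Vec d) :
    Prop where
  θ_nonneg : 0 ≤ θ
  θ_le : θ ≤ 1
  close : ∀ x ∈ V, ‖x - U.starProjection x‖ ≤ θ * ‖x‖
  norm_w : ‖w‖ = 1
  orth : ∀ y ∈ U, inner ℝ y w = 0
  r_pos : 0 < r
  residual : ‖r • w - (α₁ * a₁) • n‖ ≤ τ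
  τ_le : τ ≤ α₁ * a₁ / 2

namespace OutputData

variable {d : ℕ} {n w : Vec d} {U V : Submodule ℝ (Vec d)} {θ τ α₁ a₁ r : ℝ}

lemma τ_nonneg (o : OutputData n U V θ τ α₁ a₁ r w) : 0 ≤ τ := (norm_nonneg _).trans o.residual

lemma norm_V_le (o : OutputData n U V θ τ α₁ a₁ r w) : ‖V.starProjection w‖ ≤ θ := by
  have h1 := norm_starProjection_le_of_orthogonal o.θ_nonneg o.close o.orth
  rwa [o.norm_w, mul_one] at h1

lemma norm_add_proj_le (o : OutputData n U V θ τ α₁ a₁ r w) (y : Vec d) :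
    ‖inner ℝ w y • w + U.starProjection y‖ ≤ ‖y‖ := by
  have hUw : inner ℝ w (U.starProjection y) = 0 := by
    rw [real_inner_comm]
    exact o.orth _ (Submodule.starProjection_apply_mem U y)
  refine le_of_sq_le_sq ?_ (norm_nonneg _)
  rw [norm_add_sq_real, norm_smul, o.norm_w, inner_smul_left, hUw, mul_zero, mul_zero, add_zero,
    mul_one, Real.norm_eq_abs, norm_sq_eq_starProjection_add U y]
  have h1 : inner ℝ w y = inner ℝ w (y - U.starProjection y) := by
    rw [inner_sub_right, hUw, sub_zero]
  have h2 := abs_real_inner_le_norm w (y - U.starProjection y)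
  rw [← h1, o.norm_w, one_mul] at h2
  have h3 := pow_le_pow_left₀ (abs_nonneg _) h2 2
  linarith

end OutputData

namespace MomentModel

variable {d k : ℕ} {A B : Op d} {m μ₁ n : Vec d} {W V : Submodule ℝ (Vec d)}
  {α₁ a₁ R l sA sk sB sZ : ℝ} {ε θ : ℝ} {Ahat : Op d} {mhat : Vec d}
  {U : Submodule ℝ (Vec d)}

lemma sA_pos (h : MomentModel k A B m μ₁ n W V α₁ a₁ R l sA sk sB sZ) : 0 < sA :=
  h.sZ_pos.trans_le h.sZ_le

/-- The residual `x̂ = m̂ - P_U m̂` is close to `m - P_V m = α₁ a₁ n`. -/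
lemma norm_residual_sub_le (h : MomentModel k A B m μ₁ n W V α₁ a₁ R l sA sk sB sZ) (hθ : 0 ≤ θ)
    (hUV : ∀ x ∈ U, ‖x - V.starProjection x‖ ≤ θ * ‖x‖)
    (hVU : ∀ x ∈ V, ‖x - U.starProjection x‖ ≤ θ * ‖x‖)
    (hm : ‖mhat - m‖ ≤ ε) :
    ‖(mhat - U.starProjection mhat) - (α₁ * a₁) • n‖ ≤ ε + 2 * θ * R := by
  rw [← h.m_sub]
  have h1 : (mhat - U.starProjection mhat) - (m - V.starProjection m) =
      ((mhat - m) - U.starProjection (mhat - m)) +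
        (V.starProjection m - U.starProjection (V.starProjection m)) -
        U.starProjection (m - V.starProjection m) := by
    simp only [map_sub]
    abel
  have h2 : ‖V.starProjection m - U.starProjection (V.starProjection m)‖ ≤ θ * R :=
    (hVU _ (Submodule.starProjection_apply_mem V m)).trans
      (mul_le_mul_of_nonneg_left ((Submodule.norm_starProjection_apply_le V m).trans h.norm_m) hθ)
  have h3 : ‖U.starProjection (m - V.starProjection m)‖ ≤ θ * R := by
    refine (norm_starProjection_le_of_orthogonal hθ hUV
      fun y hy => inner_starProjection_sub V m hy).trans ?_
    exact mul_le_mul_of_nonneg_left ((norm_sub_starProjection_le V m).trans h.norm_m) hθ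
  have h4 := (norm_sub_starProjection_le U (mhat - m)).trans hm
  rw [h1]
  calc _ ≤ _ := norm_sub_le _ _
    _ ≤ _ := add_le_add (norm_add_le _ _) le_rfl
    _ ≤ ε + 2 * θ * R := by linarith

lemma A_apply_eq (h : MomentModel k A B m μ₁ n W V α₁ a₁ R l sA sk sB sZ) (w : Vec d) :
    A w = (inner ℝ n w * (α₁ * a₁)) • μ₁ + A (V.starProjection w) := by
  rw [← h.A_proj w, h.starProjection_W_eq, map_add, map_smul, h.A_n, smul_smul, add_comm]

lemma inner_μ_eq (h : MomentModel k A B m μ₁ n W V α₁ a₁ R l sA sk sB sZ) (w : Vec d) :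
    inner ℝ μ₁ w = inner ℝ n w * a₁ + inner ℝ μ₁ (V.starProjection w) := by
  have h2 := inner_starProjection_sub W w h.μ_mem
  rw [inner_sub_right, sub_eq_zero] at h2
  rw [h2, h.starProjection_W_eq, inner_add_right, inner_smul_right, real_inner_comm n μ₁,
      h.inner_n_μ, add_comm]

/-- The quadratic form of `A` split along `n` and `V`. -/
lemma inner_A_eq (h : MomentModel k A B m μ₁ n W V α₁ a₁ R l sA sk sB sZ) (w : Vec d) :
    inner ℝ w (A w) = inner ℝ n w ^ 2 * (α₁ * a₁ ^ 2) +
      2 * (inner ℝ n w * (α₁ * a₁)) * inner ℝ μ₁ (V.starProjection w) +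
      inner ℝ (V.starProjection w) (A (V.starProjection w)) := by
  have hs : ∀ y z, inner ℝ (A y) z = inner ℝ y (A z) := fun y z => h.symmA y z
  have h1 : inner ℝ w (A (V.starProjection w)) =
      inner ℝ n w * (α₁ * a₁) * inner ℝ μ₁ (V.starProjection w) +
        inner ℝ (V.starProjection w) (A (V.starProjection w)) := by
    rw [← hs w]
    nth_rewrite 1 [h.A_apply_eq w]
    rw [inner_add_left, inner_smul_left, hs]
    simp
  rw [h.A_apply_eq w]
  rw [inner_add_right, h1, inner_smul_right, real_inner_comm μ₁ w, h.inner_μ_eq w]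
  ring

variable {τ r : ℝ} {w : Vec d}

lemma abs_r_sub_le
    (h : MomentModel k A B m μ₁ n W V α₁ a₁ R l sA sk sB sZ)
    (o : OutputData n U V θ τ α₁ a₁ r w) : |r - α₁ * a₁| ≤ τ := by
  have h1 := abs_norm_sub_norm_le (r • w) ((α₁ * a₁) • n)
  rw [norm_smul, norm_smul, o.norm_w, h.norm_n, Real.norm_of_nonneg o.r_pos.le,
    Real.norm_of_nonneg (mul_pos h.α_pos h.a_pos).le, mul_one, mul_one] at h1
  exact h1.trans o.residual

lemma r_ge
    (h : MomentModel k A B m μ₁ n W V α₁ a₁ R l sA sk sB sZ)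
    (o : OutputData n U V θ τ α₁ a₁ r w) : α₁ * a₁ / 2 ≤ r := by
  have h1 := (abs_le.1 (h.abs_r_sub_le o)).1
  linarith [o.τ_le]

lemma abs_inner_n_le
    (h : MomentModel k A B m μ₁ n W V α₁ a₁ R l sA sk sB sZ)
    (o : OutputData n U V θ τ α₁ a₁ r w) : |inner ℝ n w| ≤ 1 := by
  have h1 := abs_real_inner_le_norm n w
  rwa [h.norm_n, o.norm_w, one_mul] at h1

lemma norm_sub_sq
    (h : MomentModel k A B m μ₁ n W V α₁ a₁ R l sA sk sB sZ)
    (o : OutputData n U V θ τ α₁ a₁ r w) : ‖w - inner ℝ n w • n‖ ^ 2 = 1 - inner ℝ n w ^ 2 := by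
  rw [norm_sub_sq_real, norm_smul, o.norm_w, h.norm_n, inner_smul_right, real_inner_comm,
    Real.norm_eq_abs, mul_one, sq_abs]
  ring

/-- The projection of `w` to the line of `n` is the best approximation of `w` there, so the
distance is at most the relative error of the residual. -/
lemma norm_sub_smul_n_le
    (h : MomentModel k A B m μ₁ n W V α₁ a₁ R l sA sk sB sZ)
    (o : OutputData n U V θ τ α₁ a₁ r w) : ‖w - inner ℝ n w • n‖ ≤ 2 * τ / (α₁ * a₁) := by
  have hc := mul_pos h.α_pos h.a_pos
  have h1 : ‖w - inner ℝ n w • n‖ ≤ ‖w - (r⁻¹ * (α₁ * a₁)) • n‖ := by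
    refine le_of_sq_le_sq ?_ (norm_nonneg _)
    rw [h.norm_sub_sq o, norm_sub_sq_real, norm_smul, o.norm_w, h.norm_n, inner_smul_right,
      real_inner_comm, Real.norm_eq_abs, mul_one, sq_abs]
    nlinarith [sq_nonneg (r⁻¹ * (α₁ * a₁) - inner ℝ w n)]
  have h2 : w - (r⁻¹ * (α₁ * a₁)) • n = r⁻¹ • (r • w - (α₁ * a₁) • n) := by
    rw [smul_sub, smul_smul, smul_smul, inv_mul_cancel₀ o.r_pos.ne', one_smul]
  rw [h2, norm_smul, norm_inv, Real.norm_of_nonneg o.r_pos.le, inv_mul_eq_div] at h1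
  refine h1.trans ((div_le_div_of_nonneg_right o.residual o.r_pos.le).trans ?_)
  rw [div_le_div_iff₀ o.r_pos hc]
  nlinarith [h.r_ge o, o.τ_nonneg]

lemma one_sub_sq_le
    (h : MomentModel k A B m μ₁ n W V α₁ a₁ R l sA sk sB sZ)
    (o : OutputData n U V θ τ α₁ a₁ r w) : 1 - inner ℝ n w ^ 2 ≤ 2 * τ / (α₁ * a₁) := by
  have hc := mul_pos h.α_pos h.a_pos
  rw [← h.norm_sub_sq o, sq]
  have h1 := h.norm_sub_smul_n_le o
  have h2 : 2 * τ / (α₁ * a₁) ≤ 1 := by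
    rw [div_le_one hc]
    linarith [o.τ_le]
  nlinarith [norm_nonneg (w - inner ℝ n w • n)]

lemma abs_ratio_sub_le
    (h : MomentModel k A B m μ₁ n W V α₁ a₁ R l sA sk sB sZ)
    (o : OutputData n U V θ τ α₁ a₁ r w) :
    |inner ℝ n w * (α₁ * a₁) / r - 1| ≤ 4 * τ / (α₁ * a₁) := by
  have hc := mul_pos h.α_pos h.a_pos
  have hr := o.r_pos
  have h1 : |r * inner ℝ n w - α₁ * a₁| ≤ τ := by
    have h2 := abs_real_inner_le_norm n (r • w - (α₁ * a₁) • n)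
    rw [inner_sub_right, inner_smul_right, inner_smul_right, real_inner_self_eq_norm_sq, h.norm_n,
      one_pow, mul_one, one_mul] at h2
    exact h2.trans o.residual
  have h2 : inner ℝ n w * (α₁ * a₁) / r - 1 =
      -(inner ℝ n w * ((r * inner ℝ n w - α₁ * a₁) / r)) - (1 - inner ℝ n w ^ 2) := by
    field_simp
    ring
  have h3 : |inner ℝ n w * ((r * inner ℝ n w - α₁ * a₁) / r)| ≤ 2 * τ / (α₁ * a₁) := by
    rw [abs_mul, abs_div, abs_of_pos hr]
    calc _ ≤ 1 * (τ / r) := by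
          refine mul_le_mul (h.abs_inner_n_le o) (div_le_div_of_nonneg_right h1 hr.le)
            (by positivity) zero_le_one
      _ ≤ _ := by
        rw [one_mul, div_le_div_iff₀ hr hc]
        nlinarith [h.r_ge o, o.τ_nonneg]
  have h4 := h.one_sub_sq_le o
  have h5 : 0 ≤ 1 - inner ℝ n w ^ 2 := by
    rw [← h.norm_sub_sq o]
    positivity
  rw [h2]
  have h6 := abs_le.1 h3
  have h7 : 4 * τ / (α₁ * a₁) = 2 * τ / (α₁ * a₁) + 2 * τ / (α₁ * a₁) := by ring
  rw [abs_le, h7]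
  constructor <;> linarith [h6.1, h6.2]

/-- `μ₁` nearly lies in the span of `U` and `w`. -/
lemma norm_μ_sub_proj_le
    (h : MomentModel k A B m μ₁ n W V α₁ a₁ R l sA sk sB sZ)
    (o : OutputData n U V θ τ α₁ a₁ r w) :
    ‖(inner ℝ w μ₁ • w + U.starProjection μ₁) - μ₁‖ ≤ θ * ‖μ₁‖ + 2 * τ / α₁ := by
  have hα := h.α_pos
  have ha := h.a_pos
  set q := V.starProjection μ₁ with hq
  have hμ : μ₁ = q + a₁ • n := by
    have h1 := h.decomp _ h.μ_mem
    rw [h.inner_n_μ] at h1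
    exact h1.symm
  have hUw : U.starProjection w = 0 := by
    refine Submodule.eq_starProjection_of_mem_of_inner_eq_zero U.zero_mem fun y hy => ?_
    rw [sub_zero, real_inner_comm]
    exact o.orth y hy
  -- Removing the component along the unit vector `w` does not increase the norm.
  have hproj : ∀ z : Vec d, ‖inner ℝ w z • w - z‖ ≤ ‖z‖ := by
    intro z
    refine le_of_sq_le_sq ?_ (norm_nonneg _)
    rw [norm_sub_sq_real, norm_smul, o.norm_w, inner_smul_left, mul_one, Real.norm_eq_abs, sq_abs]
    simp only [conj_trivial]
    nlinarith [sq_nonneg (inner ℝ w z)]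
  have h1 : ‖(inner ℝ w q • w + U.starProjection q) - q‖ ≤ θ * ‖μ₁‖ := by
    have h2 : inner ℝ w (U.starProjection q) = 0 := by
      rw [real_inner_comm]
      exact o.orth _ (Submodule.starProjection_apply_mem U q)
    have h3 : (inner ℝ w q • w + U.starProjection q) - q =
        inner ℝ w (q - U.starProjection q) • w - (q - U.starProjection q) := by
      rw [inner_sub_right, h2, sub_zero]
      abel
    rw [h3]
    calc _ ≤ _ := hproj _
      _ ≤ θ * ‖q‖ := o.close q (Submodule.starProjection_apply_mem V μ₁)
      _ ≤ _ := mul_le_mul_of_nonneg_left (Submodule.norm_starProjection_apply_le V μ₁) o.θ_nonneg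
  have h2 : ‖(inner ℝ w n • w + U.starProjection n) - n‖ ≤ 2 * τ / (α₁ * a₁) := by
    have h3 : (inner ℝ w n • w + U.starProjection n) - n =
        -((n - inner ℝ w n • w) - U.starProjection (n - inner ℝ w n • w)) := by
      rw [map_sub, map_smul, hUw]
      module
    have h4 : ‖n - inner ℝ w n • w‖ = ‖w - inner ℝ n w • n‖ := by
      rw [← sq_eq_sq₀ (norm_nonneg _) (norm_nonneg _), h.norm_sub_sq o, norm_sub_sq_real,
        norm_smul, o.norm_w, h.norm_n, inner_smul_right, Real.norm_eq_abs, mul_one, sq_abs,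
        real_inner_comm w n]
      ring
    rw [h3, norm_neg]
    exact (norm_sub_starProjection_le U _).trans (h4.trans_le (h.norm_sub_smul_n_le o))
  have h3 : (inner ℝ w μ₁ • w + U.starProjection μ₁) - μ₁ =
      ((inner ℝ w q • w + U.starProjection q) - q) +
        a₁ • ((inner ℝ w n • w + U.starProjection n) - n) := by
    rw [hμ, inner_add_right, inner_smul_right, map_add, map_smul]
    module
  rw [h3]
  refine (norm_add_le _ _).trans (add_le_add h1 ?_)
  rw [norm_smul, Real.norm_of_nonneg ha.le]
  refine (mul_le_mul_of_nonneg_left h2 ha.le).trans_eq ?_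
  field_simp

/-- Error of the estimated mean, in terms of the angle error `θ` and the residual error `τ`. -/
lemma norm_mean_sub_le
    (h : MomentModel k A B m μ₁ n W V α₁ a₁ R l sA sk sB sZ)
    (o : OutputData n U V θ τ α₁ a₁ r w) (hA : ∀ x, ‖Ahat x - A x‖ ≤ ε * ‖x‖) :
    ‖r⁻¹ • (inner ℝ w (Ahat w) • w + U.starProjection (Ahat w)) - μ₁‖ ≤
      2 * (ε + sA * θ) / (α₁ * a₁) + 4 * τ * ‖μ₁‖ / (α₁ * a₁) + θ * ‖μ₁‖ + 2 * τ / α₁ := by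
  have hc := mul_pos h.α_pos h.a_pos
  have hr := o.r_pos
  set s := inner ℝ n w with hs
  set y := (Ahat w - A w) + A (V.starProjection w) with hy
  have hAw : Ahat w = y + (s * (α₁ * a₁)) • μ₁ := by
    rw [hy, h.A_apply_eq w]
    abel
  have hsplit : r⁻¹ • (inner ℝ w (Ahat w) • w + U.starProjection (Ahat w)) - μ₁ =
      r⁻¹ • (inner ℝ w y • w + U.starProjection y) +
        (s * (α₁ * a₁) / r - 1) • (inner ℝ w μ₁ • w + U.starProjection μ₁) +
        ((inner ℝ w μ₁ • w + U.starProjection μ₁) - μ₁) := by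
    rw [hAw, inner_add_right, inner_smul_right, map_add, map_smul]
    match_scalars <;> field_simp <;> ring
  have h1 : ‖r⁻¹ • (inner ℝ w y • w + U.starProjection y)‖ ≤ 2 * (ε + sA * θ) / (α₁ * a₁) := by
    have h2 : ‖y‖ ≤ ε + sA * θ := by
      refine (norm_add_le _ _).trans (add_le_add ?_ ?_)
      · have := hA w
        rwa [o.norm_w, mul_one] at this
      · exact (h.A_le _).trans (mul_le_mul_of_nonneg_left (o.norm_V_le) h.sA_pos.le)
    rw [norm_smul, norm_inv, Real.norm_of_nonneg hr.le, inv_mul_eq_div]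
    refine (div_le_div_of_nonneg_right ((o.norm_add_proj_le y).trans h2) hr.le).trans ?_
    rw [div_le_div_iff₀ hr hc]
    nlinarith [h.r_ge o, (norm_nonneg y).trans h2]
  have h2 : ‖(s * (α₁ * a₁) / r - 1) • (inner ℝ w μ₁ • w + U.starProjection μ₁)‖ ≤
      4 * τ * ‖μ₁‖ / (α₁ * a₁) := by
    rw [norm_smul, Real.norm_eq_abs]
    refine (mul_le_mul (h.abs_ratio_sub_le o) (o.norm_add_proj_le μ₁) (norm_nonneg _)
      ((abs_nonneg _).trans (h.abs_ratio_sub_le o))).trans_eq ?_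
    ring
  have h3 := h.norm_μ_sub_proj_le o
  rw [hsplit]
  calc _ ≤ _ := norm_add_le _ _
    _ ≤ _ := add_le_add (norm_add_le _ _) le_rfl
    _ ≤ _ := by linarith

lemma abs_inner_sub_le_output
    (h : MomentModel k A B m μ₁ n W V α₁ a₁ R l sA sk sB sZ)
    (o : OutputData n U V θ τ α₁ a₁ r w) (hA : ∀ x, ‖Ahat x - A x‖ ≤ ε * ‖x‖) :
    |inner ℝ w (Ahat w) - α₁ * a₁ ^ 2| ≤
      ε + 2 * τ * a₁ + 2 * α₁ * a₁ * ‖μ₁‖ * θ + sA * θ := by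
  have hα := h.α_pos
  have ha := h.a_pos
  have hc := mul_pos hα ha
  set s := inner ℝ n w with hs
  set y := V.starProjection w with hy
  have hyθ : ‖y‖ ≤ θ := o.norm_V_le
  have h1 := abs_inner_sub_le hA w
  rw [o.norm_w, one_pow, mul_one] at h1
  have h2 : (1 - s ^ 2) * (α₁ * a₁ ^ 2) ≤ 2 * τ * a₁ := by
    refine (mul_le_mul_of_nonneg_right (h.one_sub_sq_le o) (by positivity)).trans_eq ?_
    field_simp
  have h2' : 0 ≤ (1 - s ^ 2) * (α₁ * a₁ ^ 2) := by
    rw [hs, ← h.norm_sub_sq o]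
    positivity
  have h3 : |2 * (s * (α₁ * a₁)) * inner ℝ μ₁ y| ≤ 2 * α₁ * a₁ * ‖μ₁‖ * θ := by
    have h4 : |inner ℝ μ₁ y| ≤ ‖μ₁‖ * θ :=
      (abs_real_inner_le_norm _ _).trans (mul_le_mul_of_nonneg_left hyθ (norm_nonneg _))
    have h5 := h.abs_inner_n_le o
    have h6 : |s| * |inner ℝ μ₁ y| ≤ 1 * (‖μ₁‖ * θ) :=
      mul_le_mul h5 h4 (abs_nonneg _) zero_le_one
    rw [abs_mul, abs_mul, abs_mul, abs_of_pos hc, abs_of_pos (zero_lt_two' ℝ)]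
    nlinarith
  have h4 : |inner ℝ y (A y)| ≤ sA * θ := by
    have h5 : |inner ℝ y (A y)| ≤ ‖y‖ * (sA * ‖y‖) :=
      (abs_real_inner_le_norm _ _).trans (mul_le_mul_of_nonneg_left (h.A_le y) (norm_nonneg _))
    have h6 : ‖y‖ * ‖y‖ ≤ 1 * θ :=
      mul_le_mul (hyθ.trans o.θ_le) hyθ (norm_nonneg _) zero_le_one
    nlinarith [h.sA_pos]
  have h5 := h.inner_A_eq w
  rw [← hs, ← hy] at h5
  rw [h5] at h1
  rw [abs_le] at *
  constructor <;> linarith [h1.1, h1.2, h3.1, h3.2, h4.1, h4.2]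

/-- Error of the estimated weight, in terms of the angle error `θ` and the residual error `τ`. -/
lemma abs_weight_sub_le
    (h : MomentModel k A B m μ₁ n W V α₁ a₁ R l sA sk sB sZ)
    (o : OutputData n U V θ τ α₁ a₁ r w) (hA : ∀ x, ‖Ahat x - A x‖ ≤ ε * ‖x‖)
    (hD : ε + 2 * τ * a₁ + 2 * α₁ * a₁ * ‖μ₁‖ * θ + sA * θ ≤ α₁ * a₁ ^ 2 / 2) :
    0 < inner ℝ w (Ahat w) ∧ |r ^ 2 / inner ℝ w (Ahat w) - α₁| ≤
      10 * τ / a₁ + 2 * ε / a₁ ^ 2 + 4 * α₁ * ‖μ₁‖ * θ / a₁ + 2 * sA * θ / a₁ ^ 2 := by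
  have hα := h.α_pos
  have ha := h.a_pos
  have hc := mul_pos hα ha
  have hc2 : 0 < α₁ * a₁ ^ 2 := by positivity
  have h1 := h.abs_inner_sub_le_output o hA
  set D := ε + 2 * τ * a₁ + 2 * α₁ * a₁ * ‖μ₁‖ * θ + sA * θ with hDdef
  set c := inner ℝ w (Ahat w) with hcdef
  have h2 : α₁ * a₁ ^ 2 / 2 ≤ c := by linarith [(abs_le.1 h1).1]
  have hcpos : 0 < c := by linarith
  refine ⟨hcpos, ?_⟩
  have h3 := h.abs_r_sub_le o
  have hτ := o.τ_nonneg
  have h4 : |r ^ 2 - (α₁ * a₁) ^ 2| ≤ 3 * τ * (α₁ * a₁) := by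
    have h5 : r ^ 2 - (α₁ * a₁) ^ 2 = (r - α₁ * a₁) * (r + α₁ * a₁) := by ring
    rw [h5, abs_mul, abs_of_pos (add_pos o.r_pos hc)]
    have h6 : r + α₁ * a₁ ≤ 3 * (α₁ * a₁) := by linarith [(abs_le.1 h3).2, o.τ_le]
    calc _ ≤ τ * (3 * (α₁ * a₁)) := mul_le_mul h3 h6 (by linarith [o.r_pos]) hτ
      _ = _ := by ring
  have h5 : r ^ 2 / c - α₁ = ((r ^ 2 - (α₁ * a₁) ^ 2) - α₁ * (c - α₁ * a₁ ^ 2)) / c := by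
    field_simp
    ring
  have h6 : |(r ^ 2 - (α₁ * a₁) ^ 2) - α₁ * (c - α₁ * a₁ ^ 2)| ≤
      3 * τ * (α₁ * a₁) + α₁ * D := by
    refine (abs_sub _ _).trans (add_le_add h4 ?_)
    rw [abs_mul, abs_of_pos hα]
    exact mul_le_mul_of_nonneg_left h1 hα.le
  have h7 : 0 ≤ 3 * τ * (α₁ * a₁) + α₁ * D := (abs_nonneg _).trans h6
  rw [h5, abs_div, abs_of_pos hcpos]
  calc _ ≤ (3 * τ * (α₁ * a₁) + α₁ * D) / (α₁ * a₁ ^ 2 / 2) :=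
        div_le_div₀ h7 h6 (by positivity) h2
    _ = _ := by
      rw [hDdef]
      field_simp
      ring

end MomentModel

/-! ### Size of the errors -/

lemma one_le_etaThree (l sB : ℝ) : 1 ≤ etaThree l sB := le_max_left _ _

lemma le_etaThree (l sB : ℝ) : l ≤ etaThree l sB := (le_max_left _ _).trans (le_max_right _ _)

/-- The relative error allowed for the result of the line search. -/
noncomputable def lineError (α₁ a₁ l ε : ℝ) : ℝ := 4 * ε * (1 + l) / (α₁ * a₁ ^ 2)

/-- The error allowed for the angle between `V` and its estimate, when `M = ‖μ₁‖`. -/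
noncomputable def angleError (a₁ l sZ M ε : ℝ) : ℝ := 24 * ε * (1 + l) * M / (a₁ * sZ)

/-- The conditions on the size of `ε` under which the error analysis is valid. -/
structure SmallError (α₁ a₁ R l sA sk sB sZ ε : ℝ) : Prop where
  le_sk : ε ≤ sk / 4
  lineError_le : lineError α₁ a₁ l ε ≤ 1 / 2
  lineError_mul_le : lineError α₁ a₁ l ε * (α₁ * R ^ 2) ≤ sZ / 4
  le_sZ : 2 * ε * (1 + l) ≤ sZ / 4
  pencil_le : ε * (1 + 2 * l) + l * lineError α₁ a₁ l ε * sB ≤ sZ / 2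
  angle_le : angleError a₁ l sZ R ε ≤ 1
  residual_le : ε + 2 * angleError a₁ l sZ R ε * R ≤ α₁ * a₁ / 2
  weight_le : ε + 2 * (ε + 2 * angleError a₁ l sZ R ε * R) * a₁ +
    2 * α₁ * a₁ * R * angleError a₁ l sZ R ε + sA * angleError a₁ l sZ R ε ≤ α₁ * a₁ ^ 2 / 2

open Filter Topology in
lemma exists_smallError (α₁ a₁ R l sA sk sB sZ : ℝ) :
    ∃ ε₀ : ℝ, 0 < ε₀ ∧ (0 < α₁ → 0 < a₁ → 0 < sk → 0 < sZ →
      ∀ ε, 0 < ε → ε ≤ ε₀ → SmallError α₁ a₁ R l sA sk sB sZ ε) := by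
  by_cases hpos : 0 < α₁ ∧ 0 < a₁ ∧ 0 < sk ∧ 0 < sZ
  · obtain ⟨hα, ha, hsk, hsZ⟩ := hpos
    -- every condition bounds a continuous function that vanishes at `ε = 0`
    have key : ∀ {f : ℝ → ℝ} {c : ℝ}, Continuous f → f 0 = 0 → 0 < c →
        ∀ᶠ ε in 𝓝 (0 : ℝ), f ε ≤ c := by
      intro f c hf h0 hc
      have h1 : Tendsto f (𝓝 0) (𝓝 0) := by
        have h2 := hf.tendsto 0
        rwa [h0] at h2
      exact (h1.eventually_lt_const hc).mono fun _ h => h.le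
    have hline : Continuous fun ε => lineError α₁ a₁ l ε := by
      unfold lineError
      fun_prop
    have hangle : Continuous fun ε => angleError a₁ l sZ R ε := by
      unfold angleError
      fun_prop
    have hline0 : lineError α₁ a₁ l 0 = 0 := by simp [lineError]
    have hangle0 : angleError a₁ l sZ R 0 = 0 := by simp [angleError]
    have hev : ∀ᶠ ε in 𝓝 (0 : ℝ), SmallError α₁ a₁ R l sA sk sB sZ ε := by
      filter_upwards [
        key (f := fun ε => ε) (c := sk / 4) (by fun_prop) rfl (by positivity),
        key (f := fun ε => lineError α₁ a₁ l ε) (c := 1 / 2) hline hline0 (by positivity),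
        key (f := fun ε => lineError α₁ a₁ l ε * (α₁ * R ^ 2)) (c := sZ / 4) (by fun_prop)
          (by simp [hline0]) (by positivity),
        key (f := fun ε => 2 * ε * (1 + l)) (c := sZ / 4) (by fun_prop) (by simp) (by positivity),
        key (f := fun ε => ε * (1 + 2 * l) + l * lineError α₁ a₁ l ε * sB) (c := sZ / 2)
          (by fun_prop) (by simp [hline0]) (by positivity),
        key (f := fun ε => angleError a₁ l sZ R ε) (c := 1) hangle hangle0 one_pos,
        key (f := fun ε => ε + 2 * angleError a₁ l sZ R ε * R) (c := α₁ * a₁ / 2) (by fun_prop)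
          (by simp [hangle0]) (by positivity),
        key (f := fun ε => ε + 2 * (ε + 2 * angleError a₁ l sZ R ε * R) * a₁ +
          2 * α₁ * a₁ * R * angleError a₁ l sZ R ε + sA * angleError a₁ l sZ R ε)
          (c := α₁ * a₁ ^ 2 / 2) (by fun_prop) (by simp [hangle0]) (by positivity)]
        with ε h1 h2 h3 h4 h5 h6 h7 h8
      exact ⟨h1, h2, h3, h4, h5, h6, h7, h8⟩
    obtain ⟨ρ, hρ, hball⟩ := Metric.eventually_nhds_iff.1 hev
    refine ⟨ρ / 2, by positivity, fun _ _ _ _ ε hε hle => hball ?_⟩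
    rw [Real.dist_eq, sub_zero, abs_of_pos hε]
    linarith
  · exact ⟨1, one_pos, fun h1 h2 h3 h4 => absurd ⟨h1, h2, h3, h4⟩ hpos⟩

section Scalars

variable {α a M R l sA sB sZ ε : ℝ}

/-- The error bound of `MomentModel.norm_mean_sub_le` implies the stated one. -/
lemma mean_error_lt (hα : 0 < α) (hα1 : α ≤ 1) (ha : 0 < a) (haM : a ≤ M) (hMR : M ≤ R)
    (hl : 0 < l) (hsZ : 0 < sZ) (hsZA : sZ ≤ sA) (hA : α * M ^ 2 ≤ sA) (hε : 0 < ε)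
    {θ τ : ℝ} (hθ : θ = angleError a l sZ M ε) (hτ : τ = ε + 2 * θ * R) :
    2 * (ε + sA * θ) / (α * a) + 4 * τ * M / (α * a) + θ * M + 2 * τ / α <
      muBound 1000 ε α a R l sA sB sZ := by
  have hM : 0 < M := ha.trans_le haM
  have hR : 0 < R := hM.trans_le hMR
  have hsA : 0 < sA := hsZ.trans_le hsZA
  rw [muBound]
  set E := etaThree l sB with hEdef
  have hE1 : 1 ≤ E := one_le_etaThree l sB
  have hEl : l ≤ E := le_etaThree l sB
  -- `T = θ a sZ` is free of denominators; both sides are put over a common denominator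
  set T := 24 * ε * (1 + l) * M with hT
  have hTE : T ≤ 48 * (ε * E * M) := by
    rw [hT]
    nlinarith [mul_pos hε hM]
  have hT0 : 0 ≤ T := by positivity
  have hθT : θ = T / (a * sZ) := hθ
  have hlhs : 2 * (ε + sA * θ) / (α * a) + 4 * τ * M / (α * a) + θ * M + 2 * τ / α =
      (2 * ε * (α * a * sZ) + 2 * sA * (α * T) + 4 * ε * (α * (M * a)) * sZ +
        8 * R * (α * M * T) + α * a * (α * M * T) + 2 * ε * (α * a ^ 2) * sZ +
        4 * R * (α * a * T)) / (α ^ 2 * a ^ 2 * sZ) := by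
    rw [hτ, hθT]
    field_simp
    ring
  have hrhs : 1000 * ε / (α ^ 2 * a ^ 2) * (sA * (1 + α * a / sZ) + sA * E * R / sZ) =
      1000 * ε * (sA * (sZ + α * a + E * R)) / (α ^ 2 * a ^ 2 * sZ) := by
    field_simp
  rw [hlhs, hrhs]
  refine div_lt_div_of_pos_right ?_ (by positivity)
  have hMa : α * (M * a) ≤ sA :=
    (mul_le_mul_of_nonneg_left (by nlinarith) hα.le).trans hA
  have haa : α * a ^ 2 ≤ sA :=
    (mul_le_mul_of_nonneg_left (pow_le_pow_left₀ ha.le haM 2) hα.le).trans hA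
  have haR : a ≤ R := haM.trans hMR
  have hU : 0 < ε * E * (R * sA) := by positivity
  have hMT : α * M * T ≤ 48 * (ε * E * sA) := by
    calc α * M * T ≤ α * M * (48 * (ε * E * M)) := by gcongr
      _ = 48 * (ε * E * (α * M ^ 2)) := by ring
      _ ≤ _ := by gcongr
  have haT : α * a * T ≤ 48 * (ε * E * sA) := by
    refine le_trans ?_ hMT
    gcongr
  have h1 : 2 * ε * (α * a * sZ) ≤ 2 * ε * (sA * (α * a)) := by
    rw [mul_comm sA]
    gcongr
  have h2 : 2 * sA * (α * T) ≤ 96 * (ε * E * (R * sA)) := by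
    have : α * T ≤ 48 * (ε * E * R) := by
      calc α * T ≤ 1 * T := by gcongr
        _ ≤ 48 * (ε * E * M) := by rw [one_mul]; exact hTE
        _ ≤ _ := by gcongr
    linarith [mul_le_mul_of_nonneg_left this hsA.le]
  have h3 : 4 * ε * (α * (M * a)) * sZ ≤ 4 * ε * sA * sZ := by gcongr
  have h4 : 8 * R * (α * M * T) ≤ 384 * (ε * E * (R * sA)) := by
    linarith [mul_le_mul_of_nonneg_left hMT hR.le]
  have h5 : α * a * (α * M * T) ≤ 48 * (ε * E * (R * sA)) := by
    calc α * a * (α * M * T) ≤ 1 * R * (48 * (ε * E * sA)) := by gcongr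
      _ = _ := by ring
  have h6 : 2 * ε * (α * a ^ 2) * sZ ≤ 2 * ε * sA * sZ := by gcongr
  have h7 : 4 * R * (α * a * T) ≤ 192 * (ε * E * (R * sA)) := by
    linarith [mul_le_mul_of_nonneg_left haT hR.le]
  have h8 : 0 < ε * sA * sZ := by positivity
  have h9 : 0 < ε * (sA * (α * a)) := by positivity
  linarith

/-- The error bound of `MomentModel.abs_weight_sub_le` implies the stated one. -/
lemma weight_error_lt (hα : 0 < α) (hα1 : α ≤ 1) (ha : 0 < a) (haM : a ≤ M) (hMR : M ≤ R)
    (hl : 0 < l) (hsZ : 0 < sZ) (hsZA : sZ ≤ sA) (hA : α * M ^ 2 ≤ sA) (hε : 0 < ε)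
    {θ τ : ℝ} (hθ : θ = angleError a l sZ M ε) (hτ : τ = ε + 2 * θ * R) :
    10 * τ / a + 2 * ε / a ^ 2 + 4 * α * M * θ / a + 2 * sA * θ / a ^ 2 <
      alphaBound 1000 ε α a R l sA sB sZ := by
  have hM : 0 < M := ha.trans_le haM
  have hR : 0 < R := hM.trans_le hMR
  have hsA : 0 < sA := hsZ.trans_le hsZA
  rw [alphaBound]
  set E := etaThree l sB with hEdef
  have hE1 : 1 ≤ E := one_le_etaThree l sB
  have hEl : l ≤ E := le_etaThree l sB
  have hη1 : 20 ≤ etaOne α a := le_max_right _ _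
  have hη2 : 10 ≤ etaTwo α a := le_max_right _ _
  -- `T = θ a sZ` is free of denominators; both sides are put over a common denominator
  set T := 24 * ε * (1 + l) * M with hT
  have hTE : T ≤ 48 * (ε * E * M) := by
    rw [hT]
    nlinarith [mul_pos hε hM]
  have hT0 : 0 ≤ T := by positivity
  have hθT : θ = T / (a * sZ) := hθ
  have hlhs : 10 * τ / a + 2 * ε / a ^ 2 + 4 * α * M * θ / a + 2 * sA * θ / a ^ 2 =
      (10 * ε * (α * a ^ 2) * sZ + 20 * R * (α * a * T) + 2 * ε * (α * a * sZ) +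
        4 * (α * a) * (α * M * T) + 2 * sA * (α * T)) / (α * a ^ 3 * sZ) := by
    rw [hτ, hθT]
    field_simp
    ring
  have hrhs : 1000 * sA * ε / (α * a ^ 3) * (etaOne α a + etaTwo α a * R * E / sZ) =
      1000 * (etaOne α a * (ε * sA * sZ) + etaTwo α a * (ε * E * (R * sA))) /
        (α * a ^ 3 * sZ) := by
    field_simp
  rw [hlhs, hrhs]
  refine div_lt_div_of_pos_right ?_ (by positivity)
  have haa : α * a ^ 2 ≤ sA :=
    (mul_le_mul_of_nonneg_left (pow_le_pow_left₀ ha.le haM 2) hα.le).trans hA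
  have haR : a ≤ R := haM.trans hMR
  have hU : 0 < ε * E * (R * sA) := by positivity
  have hMT : α * M * T ≤ 48 * (ε * E * sA) := by
    calc α * M * T ≤ α * M * (48 * (ε * E * M)) := by gcongr
      _ = 48 * (ε * E * (α * M ^ 2)) := by ring
      _ ≤ _ := by gcongr
  have haT : α * a * T ≤ 48 * (ε * E * sA) := by
    refine le_trans ?_ hMT
    gcongr
  have h1 : 10 * ε * (α * a ^ 2) * sZ ≤ 10 * ε * sA * sZ := by gcongr
  have h2 : 20 * R * (α * a * T) ≤ 960 * (ε * E * (R * sA)) := by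
    linarith [mul_le_mul_of_nonneg_left haT hR.le]
  have h3 : 2 * ε * (α * a * sZ) ≤ 2 * (ε * E * (R * sA)) := by
    calc 2 * ε * (α * a * sZ) ≤ 2 * ε * (1 * R * sA) := by gcongr
      _ = 2 * (ε * 1 * (R * sA)) := by ring
      _ ≤ _ := by gcongr
  have h4 : 4 * (α * a) * (α * M * T) ≤ 192 * (ε * E * (R * sA)) := by
    calc 4 * (α * a) * (α * M * T) ≤ 4 * (1 * R) * (48 * (ε * E * sA)) := by gcongr
      _ = _ := by ring
  have h5 : 2 * sA * (α * T) ≤ 96 * (ε * E * (R * sA)) := by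
    have : α * T ≤ 48 * (ε * E * R) := by
      calc α * T ≤ 1 * T := by gcongr
        _ ≤ 48 * (ε * E * M) := by rw [one_mul]; exact hTE
        _ ≤ _ := by gcongr
    linarith [mul_le_mul_of_nonneg_left this hsA.le]
  have h8 : 0 < ε * sA * sZ := by positivity
  have h9 := mul_le_mul_of_nonneg_right hη1 h8.le
  have h10 := mul_le_mul_of_nonneg_right hη2 hU.le
  linarith

end Scalars

/-! ### Runs of the algorithm -/

namespace MomentModel

variable {d k : ℕ} {A B : Op d} {m μ₁ n : Vec d} {W V : Submodule ℝ (Vec d)}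
  {α₁ a₁ R l sA sk sB sZ : ℝ} {ε : ℝ} {Ahat Bhat : Op d} {mhat : Vec d}

lemma lineError_mul (h : MomentModel k A B m μ₁ n W V α₁ a₁ R l sA sk sB sZ) (ε : ℝ) :
    lineError α₁ a₁ l ε * (α₁ * a₁ ^ 2) = 4 * ε * (1 + l) := by
  have := h.α_pos
  have := h.a_pos
  rw [lineError, div_mul_cancel₀]
  positivity

lemma k_le (h : MomentModel k A B m μ₁ n W V α₁ a₁ R l sA sk sB sZ) : k ≤ d := by
  rw [← h.finrank_W]
  simpa using W.finrank_le

lemma line_search_iff (hAs : Ahat.IsSymmetric) (hBs : Bhat.IsSymmetric) {u : Fin k → Vec d}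
    (hu : Orthonormal ℝ u) (t : ℝ) :
    (gramProj u ∘L (Ahat - t • Bhat) ∘L gramProj u).IsPositive ↔
      ∀ x ∈ Submodule.span ℝ (Set.range u), 0 ≤ inner ℝ x ((Ahat - t • Bhat) x) := by
  rw [gramProj_eq_starProjection hu]
  exact isPositive_compression_iff (isSymmetric_sub_smul hAs hBs t) _

/-- The algorithm can be carried out: the set searched in the line search is closed, nonempty and
bounded above. -/
lemma nonempty_run (h : MomentModel k A B m μ₁ n W V α₁ a₁ R l sA sk sB sZ) (hε : 0 ≤ ε)
    (hs : SmallError α₁ a₁ R l sA sk sB sZ ε)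
    (hAs : Ahat.IsSymmetric) (hBs : Bhat.IsSymmetric)
    (hA : ∀ x, ‖Ahat x - A x‖ ≤ ε * ‖x‖) (hB : ∀ x, ‖Bhat x - B x‖ ≤ ε * ‖x‖) :
    Nonempty (CancellationRun k Ahat Bhat mhat) := by
  obtain ⟨u, hu⟩ := exists_isTopEigenvectors hAs h.k_le
  have hclose : ∀ x ∈ Submodule.span ℝ (Set.range u), ‖x - W.starProjection x‖ ≤ 1 / 2 * ‖x‖ :=
    fun x hx => h.close_W hs.le_sk hAs hA hu hx
  set S : Set ℝ := {t | (gramProj u ∘L (Ahat - t • Bhat) ∘L gramProj u).IsPositive} with hS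
  have hS' : S = ⋂ x ∈ Submodule.span ℝ (Set.range u),
      {t : ℝ | 0 ≤ inner ℝ x ((Ahat - t • Bhat) x)} := by
    ext t
    simp only [hS, Set.mem_ofPred_eq, Set.mem_iInter, line_search_iff hAs hBs hu.1]
  have hclosed : IsClosed S := by
    rw [hS']
    refine isClosed_biInter fun x _ => isClosed_le continuous_const ?_
    simp only [_root_.sub_apply, _root_.smul_apply]
    fun_prop
  have hne : S.Nonempty := ⟨_, (line_search_iff hAs hBs hu.1 _).2
    (h.pencil_nonneg hε hA hB hclose (h.lineError_mul ε) hs.lineError_le hs.lineError_mul_le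
      hs.le_sZ)⟩
  have hbdd : BddAbove S := ⟨_, fun t ht => h.lam_le hε hA hB (finrank_span_of_orthonormal hu.1)
    hclose (h.lineError_mul ε) hs.lineError_le ((line_search_iff hAs hBs hu.1 t).1 ht)⟩
  have hmax : IsGreatest S (sSup S) :=
    ⟨hclosed.csSup_mem hne hbdd, fun _ ht => le_csSup hbdd ht⟩
  have hTs : (ContinuousLinearMap.adjoint (Ahat - sSup S • Bhat) ∘L
      (Ahat - sSup S • Bhat)).IsSymmetric :=
    LinearMap.isSymmetric_adjoint_comp_self
      (T := ((Ahat - sSup S • Bhat : Op d) : Vec d →ₗ[ℝ] Vec d))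
  obtain ⟨u', hu'⟩ := exists_isTopEigenvectors hTs ((Nat.sub_le k 1).trans h.k_le)
  exact ⟨⟨u, hu, sSup S, hmax, u', hu'⟩⟩

/-- The line search recovers `l` up to the relative error `lineError`. -/
lemma abs_lam_sub_le (h : MomentModel k A B m μ₁ n W V α₁ a₁ R l sA sk sB sZ) (hε : 0 ≤ ε)
    (hs : SmallError α₁ a₁ R l sA sk sB sZ ε)
    (hAs : Ahat.IsSymmetric) (hBs : Bhat.IsSymmetric)
    (hA : ∀ x, ‖Ahat x - A x‖ ≤ ε * ‖x‖) (hB : ∀ x, ‖Bhat x - B x‖ ≤ ε * ‖x‖)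
    (run : CancellationRun k Ahat Bhat mhat) :
    |run.lam - l| ≤ l * lineError α₁ a₁ l ε := by
  have hclose : ∀ x ∈ Submodule.span ℝ (Set.range run.V),
      ‖x - W.starProjection x‖ ≤ 1 / 2 * ‖x‖ :=
    fun x hx => h.close_W hs.le_sk hAs hA run.isTop_V hx
  have hon := run.isTop_V.1
  have h1 := h.lam_le hε hA hB (finrank_span_of_orthonormal hon) hclose (h.lineError_mul ε)
    hs.lineError_le ((line_search_iff hAs hBs hon _).1 run.isGreatest_lam.1)
  have h2 := run.isGreatest_lam.2 ((line_search_iff hAs hBs hon _).2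
    (h.pencil_nonneg hε hA hB hclose (h.lineError_mul ε) hs.lineError_le hs.lineError_mul_le
      hs.le_sZ))
  rw [abs_le]
  constructor <;> linarith

lemma run_x₁_eq (run : CancellationRun k Ahat Bhat mhat) :
    run.x₁ = mhat - (Submodule.span ℝ (Set.range run.tailVec)).starProjection mhat := by
  rw [CancellationRun.x₁, gramProj_eq_starProjection run.isTop_tailVec.1]

/-- The angle and residual errors of a run. -/
lemma outputData_run (h : MomentModel k A B m μ₁ n W V α₁ a₁ R l sA sk sB sZ) (hε : 0 ≤ ε)
    (hs : SmallError α₁ a₁ R l sA sk sB sZ ε)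
    (hAs : Ahat.IsSymmetric) (hBs : Bhat.IsSymmetric)
    (hA : ∀ x, ‖Ahat x - A x‖ ≤ ε * ‖x‖) (hB : ∀ x, ‖Bhat x - B x‖ ≤ ε * ‖x‖)
    (hm : ‖mhat - m‖ ≤ ε) (run : CancellationRun k Ahat Bhat mhat) :
    OutputData n (Submodule.span ℝ (Set.range run.tailVec)) V (angleError a₁ l sZ ‖μ₁‖ ε)
      (ε + 2 * angleError a₁ l sZ ‖μ₁‖ ε * R) α₁ a₁ ‖run.x₁‖ run.v₁ := by
  have hl := h.l_pos
  have ha := h.a_pos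
  have hα := h.α_pos
  have hsZ := h.sZ_pos
  have hon := run.isTop_tailVec.1
  set U := Submodule.span ℝ (Set.range run.tailVec) with hU
  set θ := angleError a₁ l sZ ‖μ₁‖ ε with hθ
  have hθ0 : 0 ≤ θ := by rw [hθ, angleError]; positivity
  have hR : 0 ≤ R := (norm_nonneg _).trans h.norm_m
  have hθR : θ ≤ angleError a₁ l sZ R ε := by
    rw [hθ, angleError, angleError]
    have := h.norm_μ
    gcongr
  have hθ1 : θ ≤ 1 := hθR.trans hs.angle_le
  have hclose : ∀ x ∈ U, ‖x - V.starProjection x‖ ≤ θ / 2 * ‖x‖ := by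
    intro x hx
    have h1 := h.close_V hε hA hB hAs hBs (h.lineError_mul ε) hs.lineError_le hs.pencil_le
      (h.abs_lam_sub_le hε hs hAs hBs hA hB run) run.isTop_tailVec hx
    refine h1.trans_eq ?_
    rw [hθ, angleError]
    ring
  have hUV : ∀ x ∈ U, ‖x - V.starProjection x‖ ≤ θ * ‖x‖ := fun x hx =>
    (hclose x hx).trans (mul_le_mul_of_nonneg_right (by linarith) (norm_nonneg _))
  have hVU : ∀ x ∈ V, ‖x - U.starProjection x‖ ≤ θ * ‖x‖ := by
    intro x hx
    have h1 := norm_sub_starProjection_le_of_close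
      ((finrank_span_of_orthonormal hon).trans h.finrank_V.symm) (by positivity) (by linarith)
      hclose hx
    linarith
  have hτ : ε + 2 * θ * R ≤ α₁ * a₁ / 2 := by
    refine le_trans ?_ hs.residual_le
    gcongr
  have hres : ‖run.x₁ - (α₁ * a₁) • n‖ ≤ ε + 2 * θ * R := by
    rw [run_x₁_eq]
    exact h.norm_residual_sub_le hθ0 hUV hVU hm
  have hc : 0 < α₁ * a₁ := mul_pos hα ha
  have hr : 0 < ‖run.x₁‖ := by
    have h1 := norm_sub_norm_le ((α₁ * a₁) • n) run.x₁
    rw [norm_sub_rev, norm_smul, h.norm_n, Real.norm_of_nonneg hc.le] at h1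
    linarith
  refine ⟨hθ0, hθ1, hVU, ?_, ?_, hr, ?_, hτ⟩
  · rw [CancellationRun.v₁, norm_smul, norm_inv, norm_norm, inv_mul_cancel₀ hr.ne']
  · intro y hy
    rw [CancellationRun.v₁, inner_smul_right, run_x₁_eq, inner_starProjection_sub U _ hy, mul_zero]
  · rwa [CancellationRun.v₁, smul_smul, mul_inv_cancel₀ hr.ne', one_smul]

lemma run_muHat_eq (hAs : Ahat.IsSymmetric) (run : CancellationRun k Ahat Bhat mhat) :
    run.muHat = ‖run.x₁‖⁻¹ • (inner ℝ run.v₁ (Ahat run.v₁) • run.v₁ +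
      (Submodule.span ℝ (Set.range run.tailVec)).starProjection (Ahat run.v₁)) := by
  rw [← gramProj_eq_starProjection run.isTop_tailVec.1, CancellationRun.muHat, smul_add, smul_smul,
    gramProj, _root_.sum_apply, Finset.smul_sum, CancellationRun.a₁, CancellationRun.c₁,
    div_eq_inv_mul]
  congr 1
  refine Finset.sum_congr rfl fun j _ => ?_
  have h1 : inner ℝ (Ahat run.v₁) (run.tailVec j) = inner ℝ run.v₁ (Ahat (run.tailVec j)) :=
    hAs _ _
  rw [InnerProductSpace.rankOne_apply, smul_smul, CancellationRun.aTail, CancellationRun.cTail,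
    ← h1, real_inner_comm, div_eq_inv_mul]

/-- Error bounds for a run on sufficiently accurate input. -/
lemma run_bounds (h : MomentModel k A B m μ₁ n W V α₁ a₁ R l sA sk sB sZ) (hε : 0 < ε)
    (hs : SmallError α₁ a₁ R l sA sk sB sZ ε)
    (hAs : Ahat.IsSymmetric) (hBs : Bhat.IsSymmetric)
    (hA : ∀ x, ‖Ahat x - A x‖ ≤ ε * ‖x‖) (hB : ∀ x, ‖Bhat x - B x‖ ≤ ε * ‖x‖)
    (hm : ‖mhat - m‖ ≤ ε) (run : CancellationRun k Ahat Bhat mhat) :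
    run.x₁ ≠ 0 ∧ run.a₁ ≠ 0 ∧ ‖run.muHat - μ₁‖ < muBound 1000 ε α₁ a₁ R l sA sB sZ ∧
      |run.alphaHat - α₁| < alphaBound 1000 ε α₁ a₁ R l sA sB sZ := by
  have hl := h.l_pos
  have ha := h.a_pos
  have hα := h.α_pos
  have hsZ := h.sZ_pos
  have hsA := h.sA_pos
  have o := h.outputData_run hε.le hs hAs hBs hA hB hm run
  set θ := angleError a₁ l sZ ‖μ₁‖ ε with hθ
  have hR : 0 ≤ R := (norm_nonneg _).trans h.norm_m
  have hμR := h.norm_μ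
  have hθ0 := o.θ_nonneg
  have hθR : θ ≤ angleError a₁ l sZ R ε := by
    rw [hθ, angleError, angleError]
    gcongr
  have hD : ε + 2 * (ε + 2 * θ * R) * a₁ + 2 * α₁ * a₁ * ‖μ₁‖ * θ + sA * θ ≤
      α₁ * a₁ ^ 2 / 2 := by
    refine le_trans ?_ hs.weight_le
    gcongr
  obtain ⟨hc, hweight⟩ := h.abs_weight_sub_le o hA hD
  have hr := o.r_pos
  have hmean := h.norm_mean_sub_le o hA
  refine ⟨norm_pos_iff.1 hr, (div_pos hc hr).ne', ?_, ?_⟩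
  · rw [run_muHat_eq hAs]
    exact hmean.trans_lt (mean_error_lt hα h.α_le ha h.a_le_norm hμR hl hsZ h.sZ_le
      h.α_mul_norm_sq_le hε hθ rfl)
  · have h1 : run.alphaHat = ‖run.x₁‖ ^ 2 / inner ℝ run.v₁ (Ahat run.v₁) := by
      rw [CancellationRun.alphaHat, CancellationRun.a₁, CancellationRun.c₁]
      field_simp
    rw [h1]
    exact hweight.trans_lt (weight_error_lt hα h.α_le ha h.a_le_norm hμR hl hsZ h.sZ_le
      h.α_mul_norm_sq_le hε hθ rfl)

end MomentModel

end Mixture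

theorem mainTheorem2 :
    ∃ (C : ℝ) (ε₀ : ℝ → ℝ → ℝ → ℝ → ℝ → ℝ → ℝ → ℝ → ℝ),
      0 < C ∧
      (∀ α₁ a₁ R lam₁ sA skA sB sZ : ℝ, 0 < ε₀ α₁ a₁ R lam₁ sA skA sB sZ) ∧
      ∀ (d k : ℕ) [NeZero k] (α : Fin k → ℝ) (μ : Fin k → Vec d) (v : Vec d) (δ ε : ℝ)
        (Ahat Bhat : Op d) (mhat : Vec d) (a₁ R lam₁ sA skA sB sZ : ℝ),
        2 ≤ k →
        (∀ i, 0 < α i) → ∑ i, α i = 1 →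
        LinearIndependent ℝ μ →
        0 < δ → (∀ i, i ≠ 0 → (1 + δ) * inner ℝ (μ i) v ≤ inner ℝ (μ 0) v) →
        0 < inner ℝ (μ 0) v →
        a₁ = Mixture.aOne μ →
        R = Mixture.maxNorm μ →
        lam₁ = Mixture.lambdaOne μ v →
        sA = Mixture.sigma 1 (Mixture.momentA α μ) →
        skA = Mixture.sigma k (Mixture.momentA α μ) →
        sB = Mixture.sigma 1 (Mixture.momentB α μ v) →
        sZ = Mixture.sigma (k - 1) (Mixture.momentA α μ - lam₁ • Mixture.momentB α μ v) →
        sZ ≤ sA →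
        Ahat.IsSymmetric → Bhat.IsSymmetric →
        ‖Ahat - Mixture.momentA α μ‖ < ε →
        ‖Bhat - Mixture.momentB α μ v‖ < ε →
        ‖mhat - Mixture.momentM α μ‖ < ε →
        ε ≤ ε₀ (α 0) a₁ R lam₁ sA skA sB sZ →
        Nonempty (Mixture.CancellationRun k Ahat Bhat mhat) ∧
        ∀ run : Mixture.CancellationRun k Ahat Bhat mhat,
          run.x₁ ≠ 0 ∧ run.a₁ ≠ 0 ∧
          ‖run.muHat - μ 0‖ < Mixture.muBound C ε (α 0) a₁ R lam₁ sA sB sZ ∧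
          |run.alphaHat - α 0| < Mixture.alphaBound C ε (α 0) a₁ R lam₁ sA sB sZ := by
  choose ε₀ hε₀ hsmall using Mixture.exists_smallError
  refine ⟨1000, ε₀, by norm_num, hε₀, ?_⟩
  rintro d k _ α μ v δ ε Ahat Bhat mhat a₁ R lam₁ sA skA sB sZ hk hα hsum hμ hδ hv hv0
    rfl rfl rfl rfl rfl rfl rfl hZA hAs hBs hA hB hm hε
  have h := Mixture.momentModel_of_mixture α μ v hk hα hsum hμ hδ hv hv0 hZA
  have hεpos : 0 < ε := (norm_nonneg _).trans_lt hA
  have hs := hsmall _ _ _ _ _ _ _ _ h.α_pos h.a_pos h.sk_pos h.sZ_pos ε hεpos hε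
  have hA' : ∀ x, ‖Ahat x - Mixture.momentA α μ x‖ ≤ ε * ‖x‖ := fun x =>
    (Ahat - Mixture.momentA α μ).le_of_opNorm_le hA.le x
  have hB' : ∀ x, ‖Bhat x - Mixture.momentB α μ v x‖ ≤ ε * ‖x‖ := fun x =>
    (Bhat - Mixture.momentB α μ v).le_of_opNorm_le hB.le x
  exact ⟨h.nonempty_run hεpos.le hs hAs hBs hA' hB',
    fun run => h.run_bounds hεpos hs hAs hBs hA' hB' hm.le run⟩
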